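/- Let $G$ be a finite group and let $p\colon Q\to M$ be a smooth principal $G$-bundle, where $Q$ and $M$ are closed smooth surfaces. Call it \emph{extendable} if there are a compact smooth $3$-manifold $W$ with boundary, a diffeomorphism $\partial W\cong Q$, and a smooth (not necessarily free) action of $G$ on $W$ which restricts to the given action of $G$ on $Q$. (1) If $M$ is diffeomorphic to the torus or to the Klein bottle, then $p$ is extendable. (2) Let $M$ be diffeomorphic to $\mathbb{R}P^2=S^2/\{\pm1\}$, and let $x\in G$ be the monodromy (defined up to conjugation) of $p$ along the loop $t\mapsto[\cos \pi t:\sin \pi t:0]$, $t\in[0,1]$, which is the middle circle of the M\"obius strip obtained from $\mathbb{R}P^2$ by removing a disc. That is, some lift of this loop to $Q$ ends at the translate by $x$ of its initial point. If $x^2=1$ and $x\neq 1$, then $p$ is extendable. Moreover, $Q$ is then diffeomorphic to a disjoint union of $|G|/2$ copies of $S^2$, and the extension $W$ can be chosen diffeomorphic to a disjoint union of $|G|/2$ closed $3$-balls. -/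

import Mathlib

open scoped Manifold ContDiff

universe u v w

/-- Euclidean `n`-space. -/
abbrev Euc (n : ℕ) : Type := EuclideanSpace ℝ (Fin n)

/-- The unit sphere `S²` in Euclidean `3`-space. -/
abbrev TwoSphere : Type := Metric.sphere (0 : Euc 3) 1

/-- The closed unit ball `D³` in Euclidean `3`-space. -/
abbrev ThreeBall : Type := Metric.closedBall (0 : Euc 3) 1

/-! ### Principal bundles with finite structure group over surfaces -/

/-- `p : Q → M` is a smooth principal `G`-bundle over a surface, for a discrete group `G`: the
group acts on `Q` by smooth maps, `p` is the quotient by a free action all of whose points have a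
neighbourhood with pairwise disjoint translates (this is local triviality, since `G` is discrete;
see `IsQuotientCoveringMap`), and `p` is a local diffeomorphism. -/
structure IsPrincipalBundle (G : Type v) [Group G] {Q : Type u} {M : Type w}
    [TopologicalSpace Q] [ChartedSpace (Euc 2) Q] [TopologicalSpace M] [ChartedSpace (Euc 2) M]
    [MulAction G Q] (p : Q → M) : Prop where
  contMDiff_smul : ∀ g : G, ContMDiff (𝓡 2) (𝓡 2) ∞ (fun q : Q => g • q)
  isQuotientCoveringMap : IsQuotientCoveringMap p G
  isLocalDiffeomorph : IsLocalDiffeomorph (𝓡 2) (𝓡 2) ∞ p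

/-- `x` is a monodromy of the bundle `p : Q → M` along the loop `γ`: some lift of `γ` to `Q` ends
at the translate by `x` of its initial point (equivalently, the pullback of `p` along `γ` is
`[0,1] × G` with the two ends glued by `x`).  It is well defined up to conjugation. -/
def HasMonodromy {G : Type v} [Group G] {Q : Type u} {M : Type w} [TopologicalSpace Q]
    [MulAction G Q] (p : Q → M) (γ : unitInterval → M) (x : G) : Prop :=
  ∃ Γ : C(unitInterval, Q), (∀ t, p (Γ t) = γ t) ∧ Γ 1 = x • Γ 0

/-! ### The torus, the Klein bottle and the projective plane -/

/-- `f` exhibits the surface `M` as the smooth quotient of the surface `S` by the relation `R`. -/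
structure IsSmoothQuotient {S : Type u} {M : Type w}
    [TopologicalSpace S] [ChartedSpace (Euc 2) S] [TopologicalSpace M] [ChartedSpace (Euc 2) M]
    (f : S → M) (R : S → S → Prop) : Prop where
  isLocalDiffeomorph : IsLocalDiffeomorph (𝓡 2) (𝓡 2) ∞ f
  surjective : Function.Surjective f
  apply_eq_iff : ∀ a b : S, f a = f b ↔ R a b

/-- `M` is diffeomorphic to the torus `ℝ² / ℤ²`. -/
def IsTorus (M : Type w) [TopologicalSpace M] [ChartedSpace (Euc 2) M] : Prop :=
  ∃ f : Euc 2 → M, IsSmoothQuotient f fun a b =>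
    ∃ m n : ℤ, b 0 = a 0 + m ∧ b 1 = a 1 + n

/-- `M` is diffeomorphic to the Klein bottle: the quotient of `ℝ²` by the group of all
`(s, t) ↦ (s + m, (-1)^m t + n)` with `m, n ∈ ℤ`. -/
def IsKleinBottle (M : Type w) [TopologicalSpace M] [ChartedSpace (Euc 2) M] : Prop :=
  ∃ f : Euc 2 → M, IsSmoothQuotient f fun a b =>
    ∃ m n : ℤ, b 0 = a 0 + m ∧ b 1 = (-1 : ℝ) ^ m * a 1 + n

/-- `f` identifies `M` with the real projective plane `S² / {±1}`. -/
def IsProjectivePlane {M : Type w} [TopologicalSpace M] [ChartedSpace (Euc 2) M]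
    (f : TwoSphere → M) : Prop :=
  IsSmoothQuotient f fun a b => b = a ∨ b = -a

/-- The half equator `t ↦ (cos πt, sin πt, 0)` of `S²`, from `(1, 0, 0)` to `(-1, 0, 0)`. -/
noncomputable def halfEquator (t : unitInterval) : TwoSphere :=
  ⟨!₂[Real.cos (Real.pi * t), Real.sin (Real.pi * t), 0], by
    simp [EuclideanSpace.norm_eq, Fin.sum_univ_three]⟩

/-- The loop in the projective plane that runs once around the middle circle of the Möbius strip
which is the complement of a disc around the image of the poles. -/
noncomputable def middleCircle {M : Type w} (f : TwoSphere → M) : unitInterval → M :=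
  fun t => f (halfEquator t)

/-! ### Equivariant fillings -/

/-- `W`, with the boundary identification `i : Q → W`, is a compact smooth `3`-manifold with
boundary `Q` and with a smooth action of `G` which restricts to the action of `G` on `Q`. -/
structure IsEquivariantFilling (G : Type v) [Group G] {Q : Type u} {W : Type w}
    [TopologicalSpace Q] [ChartedSpace (Euc 2) Q] [MulAction G Q]
    [TopologicalSpace W] [ChartedSpace (EuclideanHalfSpace 3) W] [MulAction G W]
    (i : Q → W) : Prop where
  isManifold : IsManifold (𝓡∂ 3) ∞ W
  t2Space : T2Space W
  compactSpace : CompactSpace W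
  contMDiff_smul : ∀ g : G, ContMDiff (𝓡∂ 3) (𝓡∂ 3) ∞ (fun y : W => g • y)
  isSmoothEmbedding : Manifold.IsSmoothEmbedding (𝓡 2) (𝓡∂ 3) ∞ i
  range_eq_boundary : Set.range i = (𝓡∂ 3).boundary W
  equivariant : ∀ (g : G) (q : Q), i (g • q) = g • i q

/-- The action of `G` on the closed surface `Q` extends to an action on a compact `3`-manifold
with boundary `Q`. -/
def IsExtendable (G : Type v) [Group G] (Q : Type u)
    [TopologicalSpace Q] [ChartedSpace (Euc 2) Q] [MulAction G Q] : Prop :=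
  ∃ (W : Type u) (_ : TopologicalSpace W) (_ : ChartedSpace (EuclideanHalfSpace 3) W)
    (_ : MulAction G W) (i : Q → W), IsEquivariantFilling G i

/-- `Q` is diffeomorphic to the disjoint union of `n` copies of the sphere `S²`. -/
def IsUnionOfSpheres (n : ℕ) (Q : Type u) [TopologicalSpace Q] [ChartedSpace (Euc 2) Q] : Prop :=
  ∃ e : Q ≃ₜ Fin n × TwoSphere,
    ContMDiff (𝓡 2) (𝓡 2) ∞ (fun q => (e q).2) ∧
    ∀ k : Fin n, ContMDiff (𝓡 2) (𝓡 2) ∞ (fun a : TwoSphere => e.symm (k, a))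

/-- `W` is diffeomorphic to the disjoint union of `n` copies of the closed ball `D³`. The smooth
structure of `D³` is the one it has as a subset of `ℝ³`. -/
def IsUnionOfBalls (n : ℕ) (W : Type u) [TopologicalSpace W]
    [ChartedSpace (EuclideanHalfSpace 3) W] : Prop :=
  ∃ (e : W ≃ₜ Fin n × ThreeBall) (ψ : Fin n → Euc 3 → W),
    ContMDiff (𝓡∂ 3) (𝓡 3) ∞ (fun y => ((e y).2 : Euc 3)) ∧
    ∀ k : Fin n, ContMDiffOn (𝓡 3) (𝓡∂ 3) ∞ (ψ k) (Metric.closedBall 0 1) ∧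
      ∀ a : ThreeBall, ψ k a = e.symm (k, a)

/-- The action of `G` on `Q` extends to an action on a disjoint union of `n` closed `3`-balls with
boundary `Q`. -/
def IsExtendableToBalls (n : ℕ) (G : Type v) [Group G] (Q : Type u)
    [TopologicalSpace Q] [ChartedSpace (Euc 2) Q] [MulAction G Q] : Prop :=
  ∃ (W : Type u) (_ : TopologicalSpace W) (_ : ChartedSpace (EuclideanHalfSpace 3) W)
    (_ : MulAction G W) (i : Q → W), IsEquivariantFilling G i ∧ IsUnionOfBalls n W

/-! Let `f : S → M` be the universal covering, with `S` the plane or the sphere, and let `Γ` be its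
deck group. By unique path lifting the continuous lifts of `f` to `Q` form a set `L` on which `G`
acts simply transitively by postcomposition, and `Γ` acts on `L` by precomposition, commuting with
`G`. Evaluation `(a, F) ↦ F a` identifies `Q` with `(S × L) / Γ`. If the action of `Γ` on `S` is
carried by a map `j` from `S` onto the boundary of a solid `T` on which `Γ` acts by smooth
isometries, then `W = (T × L) / Γ` is the filling, with `G` acting on the index alone.

For the flat surfaces `T` is the solid cylinder `{‖z‖ ≤ 1}` in `ℂ × ℝ`. Translation by `(0, 1)`
multiplies a lift by some `y ∈ G` of order `N`, so all lifts are `N`-periodic in the second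
coordinate and factor through `(s, t) ↦ (exp (2πit/N), s)`. The deck transformation with translation
parts `m, n` shifts the axis by `m` and rotates the disc by `n/N` turns, after a conjugation when
the sign requires it. If it fixes a lift, either `m ≠ 0` and every point moves by at least `1`, or
`m = 0`, `N ∣ n` and it is the identity on `T`. Hence `W` is a manifold.

For the projective plane `T` is the ball and `Γ = {±1}`. The monodromy says that `-1` acts on some
lift as `x`, so for `x ≠ 1` it fixes no lift, and `W` is one ball for each of the `|G|/2` pairs of
lifts.

The general construction is `isExtendable_of_isTubeBoundary`. It rests on `exists_isSmoothChart` for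
the charts and on `boundaryMap_apply` for the boundary identification; `exists_period` and
`exists_neg_one_smul_eq` supply the input from the bundle. -/

section

open Set Filter Topology

/-! ### Quotients of solid tubes -/

/-- The solid tube `{(z, b) : ‖z‖ ≤ 1}` in a product `V × B` of normed spaces. -/
abbrev Tube (V B : Type) [NormedAddCommGroup V] : Type := {v : V × B // ‖v.1‖ ≤ 1}

/-- A group acting by smooth isometries on the tube in `V × B` and on an index type `ι`, such
that the stabiliser of an index moves each point of `V × B` by at least `1`, or not at all. -/
class IsTubeAction (Γ : Type) (V B : Type) (ι : Type u) [Group Γ]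
    [NormedAddCommGroup V] [NormedSpace ℝ V] [NormedAddCommGroup B] [NormedSpace ℝ B]
    [MulAction Γ V] [MulAction Γ B] [MulAction Γ ι] : Prop where
  norm_smul (γ : Γ) (z : V) : ‖γ • z‖ = ‖z‖
  dist_smul (γ : Γ) (v w : V × B) : dist (γ • v) (γ • w) = dist v w
  contDiff_smul (γ : Γ) : ContDiff ℝ ∞ (fun v : V × B => γ • v)
  -- Freeness is required only modulo elements acting trivially on the tube, since full rotations of
  -- the cylinder stabilise a sheet.
  smul_eq_or_one_le_dist (γ : Γ) (a : ι) : γ • a = a →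
    (∀ v : V × B, γ • v = v) ∨ ∀ v : V × B, 1 ≤ dist v (γ • v)

section TubeQuotient

variable (Γ : Type) (V B : Type) (ι : Type u) [Group Γ]
    [NormedAddCommGroup V] [NormedSpace ℝ V] [NormedAddCommGroup B] [NormedSpace ℝ B]
    [MulAction Γ V] [MulAction Γ B] [MulAction Γ ι] [IsTubeAction Γ V B ι]

/-- The product of the tube with an index type, viewed as a disjoint union of tubes. -/
def TubeSheets (_ : Type) (V B : Type) (ι : Type u) [NormedAddCommGroup V] : Type u :=
  Tube V B × ι

instance : TopologicalSpace (TubeSheets Γ V B ι) :=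
  letI : TopologicalSpace ι := ⊥
  inferInstanceAs (TopologicalSpace (Tube V B × ι))

instance : MulAction Γ (TubeSheets Γ V B ι) where
  smul γ x := (⟨γ • x.1.1, (IsTubeAction.norm_smul B ι γ x.1.1.1).trans_le x.1.2⟩, γ • x.2)
  one_smul x := Prod.ext (Subtype.ext (one_smul Γ x.1.1)) (one_smul Γ x.2)
  mul_smul γ δ x := Prod.ext (Subtype.ext (mul_smul γ δ x.1.1)) (mul_smul γ δ x.2)

instance : ContinuousConstSMul Γ (TubeSheets Γ V B ι) where
  continuous_const_smul γ := by
    let _ : TopologicalSpace ι := ⊥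
    have : DiscreteTopology ι := ⟨rfl⟩
    have h := (IsTubeAction.contDiff_smul (V := V) (B := B) (ι := ι) γ).continuous
    exact Continuous.prodMap
      (f := fun v : Tube V B => (⟨γ • v.1, (IsTubeAction.norm_smul B ι γ v.1.1).trans_le v.2⟩ :
        Tube V B)) (g := fun a : ι => γ • a)
      ((h.comp continuous_subtype_val).subtype_mk _) continuous_of_discreteTopology

/-- The quotient of a disjoint union of tubes by the action of `Γ`. -/
def TubeQuotient : Type u := MulAction.orbitRel.Quotient Γ (TubeSheets Γ V B ι)

instance : TopologicalSpace (TubeQuotient Γ V B ι) :=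
  inferInstanceAs (TopologicalSpace (MulAction.orbitRel.Quotient Γ (TubeSheets Γ V B ι)))

namespace TubeQuotient

variable {V B ι}

/-- The point of the tube `v` in the sheet of index `a`. -/
def sheetPoint (v : Tube V B) (a : ι) : TubeSheets Γ V B ι := (v, a)

/-- The quotient map. -/
def mk (x : TubeSheets Γ V B ι) : TubeQuotient Γ V B ι :=
  Quotient.mk (MulAction.orbitRel Γ (TubeSheets Γ V B ι)) x

theorem isOpenQuotientMap_mk : IsOpenQuotientMap (mk Γ (V := V) (B := B) (ι := ι)) :=
  MulAction.isOpenQuotientMap_quotientMk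

open Classical in
/-- The map of the sheet of index `a` to the quotient, with a junk value outside the tube. -/
noncomputable def sheet (a : ι) (v : V × B) : TubeQuotient Γ V B ι :=
  -- Being total on `V × B` lets smoothness be expressed within the closed set `‖v.1‖ ≤ 1`, with no
  -- manifold structure on the tube itself.
  mk Γ (sheetPoint Γ (if h : ‖v.1‖ ≤ 1 then ⟨v, h⟩ else ⟨0, by simp⟩) a)

variable {Γ}

theorem sheet_eq_mk (a : ι) {v : V × B} (hv : ‖v.1‖ ≤ 1) :
    sheet Γ a v = mk Γ (sheetPoint Γ ⟨v, hv⟩ a) := by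
  rw [sheet, dif_pos hv]

theorem sheet_eq_sheet_iff {a b : ι} {v w : V × B} (hv : ‖v.1‖ ≤ 1) (hw : ‖w.1‖ ≤ 1) :
    sheet Γ a v = sheet Γ b w ↔ ∃ γ : Γ, γ • v = w ∧ γ • a = b := by
  rw [sheet_eq_mk a hv, sheet_eq_mk b hw, eq_comm]
  refine (Quotient.eq (r := MulAction.orbitRel Γ (TubeSheets Γ V B ι))).trans ?_
  rw [MulAction.orbitRel_apply]
  refine exists_congr fun γ => ?_
  exact Prod.ext_iff.trans (and_congr Subtype.ext_iff Iff.rfl)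

theorem norm_smul_fst (ι : Type u) [MulAction Γ ι] [IsTubeAction Γ V B ι] (γ : Γ) (v : V × B) :
    ‖(γ • v).1‖ = ‖v.1‖ :=
  IsTubeAction.norm_smul B ι γ v.1

theorem sheet_smul (γ : Γ) (a : ι) {v : V × B} (hv : ‖v.1‖ ≤ 1) :
    sheet Γ (γ • a) (γ • v) = sheet Γ a v :=
  ((sheet_eq_sheet_iff hv ((norm_smul_fst ι γ v).trans_le hv)).2 ⟨γ, rfl, rfl⟩).symm

theorem exists_sheet_eq (y : TubeQuotient Γ V B ι) :
    ∃ (a : ι) (v : V × B), ‖v.1‖ ≤ 1 ∧ sheet Γ a v = y := by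
  obtain ⟨⟨⟨v, hv⟩, a⟩, rfl⟩ := (isOpenQuotientMap_mk Γ).surjective y
  exact ⟨a, v, hv, sheet_eq_mk a hv⟩

theorem continuousOn_sheet (a : ι) : ContinuousOn (sheet Γ (V := V) (B := B) a) {v | ‖v.1‖ ≤ 1} := by
  let _ : TopologicalSpace ι := ⊥
  rw [continuousOn_iff_continuous_domRestrict]
  have h : Continuous fun v : Tube V B => mk Γ (sheetPoint Γ v a) :=
    (isOpenQuotientMap_mk Γ).continuous.comp
      (f := fun v : Tube V B => sheetPoint Γ v a) (Continuous.prodMk_left a)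
  exact h.congr fun v => (sheet_eq_mk a v.2).symm

/-- Each sheet is open because the indices are discrete, and orbit maps of actions by homeomorphisms
are open. -/
theorem isOpen_image_sheet (a : ι) {U : Set (V × B)} (hU : IsOpen U) :
    IsOpen (sheet Γ a '' (U ∩ {v | ‖v.1‖ ≤ 1})) := by
  let _ : TopologicalSpace ι := ⊥
  have : DiscreteTopology ι := ⟨rfl⟩
  have h2 : IsOpen ((Subtype.val ⁻¹' U : Set (Tube V B)) ×ˢ ({a} : Set ι)) :=
    (hU.preimage continuous_subtype_val).prod (isOpen_discrete _)
  suffices h : sheet Γ a '' (U ∩ {v | ‖v.1‖ ≤ 1}) =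
      mk Γ '' (((Subtype.val ⁻¹' U : Set (Tube V B)) ×ˢ ({a} : Set ι) : Set (Tube V B × ι)) :
        Set (TubeSheets Γ V B ι)) from
    h ▸ (isOpenQuotientMap_mk Γ).isOpenMap _ h2
  refine Set.ext fun y => ⟨?_, ?_⟩
  · rintro ⟨v, ⟨hv, hv'⟩, rfl⟩
    exact ⟨sheetPoint Γ ⟨v, hv'⟩ a, ⟨hv, rfl⟩, (sheet_eq_mk a hv').symm⟩
  · rintro ⟨⟨v, b⟩, ⟨hv, hb⟩, rfl⟩
    obtain rfl : b = a := hb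
    exact ⟨v.1, ⟨hv, v.2⟩, sheet_eq_mk b v.2⟩

/-- Two points of a sheet at distance less than `1` are not identified. -/
theorem eq_of_sheet_eq {a : ι} {v w : V × B} (hv : ‖v.1‖ ≤ 1) (hw : ‖w.1‖ ≤ 1)
    (hvw : dist v w < 1) (h : sheet Γ a v = sheet Γ a w) : v = w := by
  obtain ⟨γ, rfl, h2⟩ := (sheet_eq_sheet_iff hv hw).1 h
  rcases IsTubeAction.smul_eq_or_one_le_dist (V := V) (B := B) γ a h2 with h3 | h3
  · exact (h3 v).symm
  · exact absurd (h3 v) (not_le.2 hvw)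

/-- The points of the orbit of `(w, b)` that lie over the index `a` are pairwise at distance at
least `1`, so they form a closed set. A ball of radius `ε` about `v` that misses it gives disjoint
images of `ε / 2`-balls, since `Γ` acts by isometries. -/
instance : T2Space (TubeQuotient Γ V B ι) := by
  refine ⟨fun x y hxy => ?_⟩
  obtain ⟨a, v, hv, rfl⟩ := exists_sheet_eq x
  obtain ⟨b, w, hw, rfl⟩ := exists_sheet_eq y
  set S : Set (V × B) := {w' | ∃ γ : Γ, γ • w = w' ∧ γ • b = a} with hS
  have hSc : IsClosed S := by
    refine Metric.isClosed_of_pairwise_le_dist one_pos ?_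
    rintro _ ⟨γ, rfl, hγ⟩ _ ⟨δ, rfl, hδ⟩ hne
    have h1 : (δ * γ⁻¹) • a = a := by rw [mul_smul, inv_smul_eq_iff.2 hγ.symm, hδ]
    have h2 : (δ * γ⁻¹) • (γ • w) = δ • w := by rw [mul_smul, inv_smul_smul]
    rcases IsTubeAction.smul_eq_or_one_le_dist (V := V) (B := B) _ a h1 with h3 | h3
    · exact absurd ((h3 (γ • w)).symm.trans h2) hne
    · simpa only [h2] using h3 (γ • w)
  have hvS : v ∉ S := by
    rintro ⟨γ, h1, h2⟩
    exact hxy ((sheet_eq_sheet_iff hw hv).2 ⟨γ, h1, h2⟩).symm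
  obtain ⟨ε, hε, hball⟩ := Metric.isOpen_iff.1 hSc.isOpen_compl v hvS
  refine ⟨_, _, isOpen_image_sheet a (Metric.isOpen_ball (x := v) (ε := ε / 2)),
    isOpen_image_sheet b (Metric.isOpen_ball (x := w) (ε := ε / 2)),
    ⟨v, ⟨Metric.mem_ball_self (half_pos hε), hv⟩, rfl⟩,
    ⟨w, ⟨Metric.mem_ball_self (half_pos hε), hw⟩, rfl⟩, ?_⟩
  rw [Set.disjoint_left]
  rintro _ ⟨v', ⟨hv1, hv2⟩, rfl⟩ ⟨w', ⟨hw1, hw2⟩, h⟩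
  obtain ⟨γ, rfl, h2⟩ := (sheet_eq_sheet_iff hw2 hv2).1 h
  refine hball (a := γ • w) ?_ ⟨γ, rfl, h2⟩
  rw [Metric.mem_ball] at hv1 hw1 ⊢
  calc dist (γ • w) v ≤ dist (γ • w) (γ • w') + dist (γ • w') v := dist_triangle _ _ _
    _ < ε / 2 + ε / 2 := by
      refine add_lt_add ?_ hv1
      rwa [IsTubeAction.dist_smul (ι := ι), dist_comm]
    _ = ε := add_halves ε

theorem compactSpace [Finite ι] {K : Set (V × B)} (hK : IsCompact K)
    (hK1 : K ⊆ {v | ‖v.1‖ ≤ 1})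
    (hK2 : ∀ v : V × B, ‖v.1‖ ≤ 1 → ∃ γ : Γ, γ • v ∈ K) : CompactSpace (TubeQuotient Γ V B ι) := by
  have h : (univ : Set (TubeQuotient Γ V B ι)) = ⋃ a : ι, sheet Γ a '' K := by
    refine (eq_univ_of_forall fun y => ?_).symm
    obtain ⟨a, v, hv, rfl⟩ := exists_sheet_eq y
    obtain ⟨γ, hγ⟩ := hK2 v hv
    exact mem_iUnion.2 ⟨γ • a, γ • v, hγ, sheet_smul γ a hv⟩
  refine ⟨?_⟩
  rw [h]
  exact isCompact_iUnion fun a => hK.image_of_continuousOn ((continuousOn_sheet a).mono hK1)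

end TubeQuotient

end TubeQuotient

/-! ### The smooth structure of a tube quotient -/

/-- Appending a first coordinate. -/
noncomputable def consEquiv : (Euc 2 × ℝ) ≃L[ℝ] Euc 3 :=
  LinearEquiv.toContinuousLinearEquiv
    { toFun := fun x => !₂[x.2, x.1 0, x.1 1]
      invFun := fun y => (!₂[y 1, y 2], y 0)
      map_add' := fun x y => by
        ext i; fin_cases i <;> simp
      map_smul' := fun c x => by
        ext i; fin_cases i <;> simp
      left_inv := fun x => by
        refine Prod.ext ?_ ?_
        · ext i; fin_cases i <;> simp
        · simp
      right_inv := fun y => by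
        ext i; fin_cases i <;> simp }

@[simp]
theorem consEquiv_apply_zero (x : Euc 2 × ℝ) : consEquiv x 0 = x.2 := rfl

theorem halfSpace_val_symm {x : Euc 3} (hx : 0 ≤ x 0) : ((𝓡∂ 3).symm x).1 = x :=
  (𝓡∂ 3).right_inv (by rw [range_modelWithCornersEuclideanHalfSpace]; exact hx)

theorem mem_range_halfSpace {x : Euc 3} : x ∈ range (𝓡∂ 3) ↔ 0 ≤ x 0 := by
  rw [range_modelWithCornersEuclideanHalfSpace]; rfl

/-- Local lifts of inverse charts stay in the tube only near the base point, so the usual `MapsTo`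
condition is weakened to an eventual one. -/
theorem ContDiffWithinAt.comp_of_eventually_mem {E F G : Type*} [NormedAddCommGroup E]
    [NormedSpace ℝ E] [NormedAddCommGroup F] [NormedSpace ℝ F] [NormedAddCommGroup G]
    [NormedSpace ℝ G] {g : F → G} {f : E → F} {s : Set E} {t : Set F} {x : E} {n : ℕ∞ω}
    (hg : ContDiffWithinAt ℝ n g t (f x)) (hf : ContDiffWithinAt ℝ n f s x)
    (h : ∀ᶠ x' in 𝓝[s] x, f x' ∈ t) : ContDiffWithinAt ℝ n (g ∘ f) s x :=
  (hg.comp x (hf.mono inter_subset_left) (t := t) (s := s ∩ f ⁻¹' t)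
    fun _ hx => hx.2).mono_of_mem_nhdsWithin (inter_mem self_mem_nhdsWithin h)

namespace TubeQuotient

variable {Γ V B : Type} {ι : Type u} [Group Γ]
    [NormedAddCommGroup V] [NormedSpace ℝ V] [NormedAddCommGroup B] [NormedSpace ℝ B]
    [MulAction Γ V] [MulAction Γ B] [MulAction Γ ι] [IsTubeAction Γ V B ι]

/-- A chart of the quotient is smooth if it is so when read in the sheets. -/
structure IsSmoothChart (h : OpenPartialHomeomorph (TubeQuotient Γ V B ι) (EuclideanHalfSpace 3)) :
    Prop where
  contDiffWithinAt_comp_sheet (a : ι) (v : V × B) : ‖v.1‖ ≤ 1 → sheet Γ a v ∈ h.source →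
    ContDiffWithinAt ℝ ∞ (fun v' => (h (sheet Γ a v')).1) {v | ‖v.1‖ ≤ 1} v
  -- The inverse chart lifts smoothly through every preimage in every sheet, so a transition map can
  -- be factored through whichever sheet is convenient.
  exists_section (y : EuclideanHalfSpace 3) (a : ι) (v : V × B) : y ∈ h.target → ‖v.1‖ ≤ 1 →
    sheet Γ a v = h.symm y → ∃ σ : Euc 3 → V × B,
      ContDiffWithinAt ℝ ∞ σ (range (𝓡∂ 3)) y.1 ∧ σ y.1 = v ∧
      ∀ᶠ y' in 𝓝[range (𝓡∂ 3)] y.1,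
        ‖(σ y').1‖ ≤ 1 ∧ sheet Γ a (σ y') = h.symm ((𝓡∂ 3).symm y')

/-- Smooth charts are smoothly compatible. -/
theorem IsSmoothChart.contDiffOn
    {h h' : OpenPartialHomeomorph (TubeQuotient Γ V B ι) (EuclideanHalfSpace 3)}
    (hh : IsSmoothChart h) (hh' : IsSmoothChart h') :
    ContDiffOn ℝ ∞ ((𝓡∂ 3) ∘ (h.symm.trans h') ∘ (𝓡∂ 3).symm)
      ((𝓡∂ 3).symm ⁻¹' (h.symm.trans h').source ∩ range (𝓡∂ 3)) := by
  rintro x ⟨hx, hxr⟩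
  obtain ⟨y, rfl⟩ := hxr
  rw [mem_preimage, (𝓡∂ 3).left_inv, OpenPartialHomeomorph.trans_source] at hx
  -- Near `y` the transition map is `(h' ∘ sheet Γ a) ∘ σ`, a composite of two smooth maps.
  obtain ⟨a, v, hv, hav⟩ := exists_sheet_eq (h.symm y)
  obtain ⟨σ, hσ, hσy, hev⟩ := hh.exists_section y a v hx.1 hv hav
  have h1 := hh'.contDiffWithinAt_comp_sheet a v hv (by rw [hav]; exact hx.2)
  rw [← hσy] at h1
  refine ((h1.comp_of_eventually_mem hσ (hev.mono fun _ h => h.1)).congr_of_eventuallyEq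
    ?_ ?_).mono inter_subset_right
  · filter_upwards [hev] with y' hy'
    simp only [Function.comp_apply, hy'.2]
    rfl
  · change (h' (h.symm ((𝓡∂ 3).symm ((𝓡∂ 3) y)))).1 = (h' (sheet Γ a (σ y.1))).1
    rw [(𝓡∂ 3).left_inv, hσy, hav]

/-- A chart of the quotient obtained from a chart of a part of a sheet. -/
theorem exists_isSmoothChart (a : ι) {U : Set (V × B)} (hU : IsOpen U) {O : Set (Euc 3)}
    (hO : IsOpen O) {χ : V × B → Euc 3} {σ : Euc 3 → V × B} (hχ : ContDiffOn ℝ ∞ χ U)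
    (hσ : ContDiffOn ℝ ∞ σ O)
    (hχU : ∀ v ∈ U, ‖v.1‖ ≤ 1 → χ v ∈ O ∧ 0 ≤ χ v 0 ∧ σ (χ v) = v)
    (hσO : ∀ y ∈ O, 0 ≤ y 0 → σ y ∈ U ∧ ‖(σ y).1‖ ≤ 1 ∧ χ (σ y) = y)
    (hdist : ∀ v ∈ U, ∀ w ∈ U, ‖v.1‖ ≤ 1 → ‖w.1‖ ≤ 1 → dist v w < 1) :
    ∃ h : OpenPartialHomeomorph (TubeQuotient Γ V B ι) (EuclideanHalfSpace 3),
      IsSmoothChart h ∧ ∀ v ∈ U, ‖v.1‖ ≤ 1 →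
        sheet Γ a v ∈ h.source ∧ (h (sheet Γ a v)).1 = χ v := by
  classical
  set D : Set (V × B) := {v | ‖v.1‖ ≤ 1} with hD
  have hinj : InjOn (sheet Γ a) (U ∩ D) := fun v hv w hw hvw =>
    eq_of_sheet_eq hv.2 hw.2 (hdist v hv.1 w hw.1 hv.2 hw.2) hvw
  set inv : TubeQuotient Γ V B ι → V × B := Function.invFunOn (sheet Γ a) (U ∩ D) with hinv
  have inv_sheet : ∀ v ∈ U, v ∈ D → inv (sheet Γ a v) = v := fun v hv hv' =>
    hinj (Function.invFunOn_mem ⟨v, ⟨hv, hv'⟩, rfl⟩) ⟨hv, hv'⟩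
      (Function.invFunOn_eq ⟨v, ⟨hv, hv'⟩, rfl⟩)
  have hsrc : IsOpen (sheet Γ a '' (U ∩ D)) := isOpen_image_sheet a hU
  have hinvc : ContinuousOn inv (sheet Γ a '' (U ∩ D)) := by
    rw [continuousOn_open_iff hsrc]
    intro N hN
    convert isOpen_image_sheet (Γ := Γ) a (hU.inter hN) using 1
    ext y
    constructor
    · rintro ⟨⟨v, ⟨hv, hv'⟩, rfl⟩, hy⟩
      rw [mem_preimage, inv_sheet v hv hv'] at hy
      exact ⟨v, ⟨⟨hv, hy⟩, hv'⟩, rfl⟩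
    · rintro ⟨v, ⟨⟨hv, hy⟩, hv'⟩, rfl⟩
      refine ⟨⟨v, ⟨hv, hv'⟩, rfl⟩, ?_⟩
      rwa [mem_preimage, inv_sheet v hv hv']
  let h : OpenPartialHomeomorph (TubeQuotient Γ V B ι) (EuclideanHalfSpace 3) :=
    { toFun := fun w => (𝓡∂ 3).symm (χ (inv w))
      invFun := fun y => sheet Γ a (σ y.1)
      source := sheet Γ a '' (U ∩ D)
      target := {y | y.1 ∈ O}
      map_source' := by
        rintro _ ⟨v, ⟨hv, hv'⟩, rfl⟩
        obtain ⟨h1, h2, h3⟩ := hχU v hv hv'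
        rw [mem_ofPred_eq, inv_sheet v hv hv', halfSpace_val_symm h2]
        exact h1
      map_target' := fun y hy => by
        obtain ⟨h1, h2, h3⟩ := hσO y.1 hy y.2
        exact ⟨_, ⟨h1, h2⟩, rfl⟩
      left_inv' := by
        rintro _ ⟨v, ⟨hv, hv'⟩, rfl⟩
        obtain ⟨h1, h2, h3⟩ := hχU v hv hv'
        simp only
        rw [inv_sheet v hv hv', halfSpace_val_symm h2, h3]
      right_inv' := fun y hy => by
        obtain ⟨h1, h2, h3⟩ := hσO y.1 hy y.2
        simp only
        rw [inv_sheet _ h1 h2, h3]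
        exact (𝓡∂ 3).left_inv y
      open_source := hsrc
      open_target := hO.preimage continuous_subtype_val
      continuousOn_toFun := by
        refine (𝓡∂ 3).continuous_symm.comp_continuousOn (hχ.continuousOn.comp hinvc ?_)
        rintro _ ⟨v, ⟨hv, hv'⟩, rfl⟩
        rwa [inv_sheet v hv hv']
      continuousOn_invFun := by
        refine (continuousOn_sheet a).comp (hσ.continuousOn.comp continuous_subtype_val.continuousOn
          fun y hy => hy) fun y hy => (hσO y.1 hy y.2).2.1 }
  have h_sheet : ∀ v ∈ U, v ∈ D → (h (sheet Γ a v)).1 = χ v := fun v hv hv' => by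
    change ((𝓡∂ 3).symm (χ (inv (sheet Γ a v)))).1 = χ v
    rw [inv_sheet v hv hv', halfSpace_val_symm (hχU v hv hv').2.1]
  refine ⟨h, ⟨?_, ?_⟩, fun v hv hv' => ⟨⟨v, ⟨hv, hv'⟩, rfl⟩, h_sheet v hv hv'⟩⟩
  · rintro b w hw ⟨v, ⟨hv, hv'⟩, hvw⟩
    -- In another sheet the chart reads as `χ` after the deck transformation `γ` that moves the
    -- point into the sheet `a`. Dually, the sections below are `σ` followed by such a `γ`.
    obtain ⟨γ, rfl, rfl⟩ := (sheet_eq_sheet_iff hw hv').1 hvw.symm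
    have hγ := IsTubeAction.contDiff_smul (V := V) (B := B) (ι := ι) γ
    have h1 : ContDiffAt ℝ ∞ (fun w' : V × B => χ (γ • w')) w :=
      (hχ.contDiffAt (hU.mem_nhds hv)).comp w hγ.contDiffAt
    have key : ∀ w' : V × B, γ • w' ∈ U → w' ∈ D → (h (sheet Γ b w')).1 = χ (γ • w') := by
      intro w' h1 h2
      rw [← sheet_smul γ b h2, h_sheet _ h1 ((norm_smul_fst ι γ w').trans_le h2)]
    refine h1.contDiffWithinAt.congr_of_eventuallyEq ?_ (key w hv hw)
    filter_upwards [self_mem_nhdsWithin,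
      mem_nhdsWithin_of_mem_nhds ((hU.preimage hγ.continuous).mem_nhds hv)] with w' h1 h2
    exact key w' h2 h1
  · intro y b w hy hw hwy
    obtain ⟨h1, h2, h3⟩ := hσO y.1 hy y.2
    obtain ⟨γ, hγ1, hγ2⟩ := (sheet_eq_sheet_iff h2 hw).1 hwy.symm
    refine ⟨fun y' => γ • σ y', ?_, hγ1, ?_⟩
    · exact ((IsTubeAction.contDiff_smul (V := V) (B := B) (ι := ι) γ).contDiffAt.comp _
        (hσ.contDiffAt (hO.mem_nhds hy))).contDiffWithinAt
    · filter_upwards [self_mem_nhdsWithin, mem_nhdsWithin_of_mem_nhds (hO.mem_nhds hy)] with y' h4 h5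
      rw [mem_range_halfSpace] at h4
      obtain ⟨h6, h7, -⟩ := hσO y' h5 h4
      refine ⟨(norm_smul_fst ι γ _).trans_le h7, ?_⟩
      rw [← hγ2, sheet_smul γ a h7]
      change _ = sheet Γ a (σ ((𝓡∂ 3).symm y').1)
      rw [halfSpace_val_symm h4]

/-- Interior points of the tube have charts with values in the interior of the half-space. -/
theorem exists_interior_chart (L : (V × B) ≃L[ℝ] Euc 3) (a : ι) {v₀ : V × B} (hv₀ : ‖v₀.1‖ < 1) :
    ∃ h : OpenPartialHomeomorph (TubeQuotient Γ V B ι) (EuclideanHalfSpace 3),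
      IsSmoothChart h ∧ sheet Γ a v₀ ∈ h.source ∧ 0 < (h (sheet Γ a v₀)).1 0 := by
  -- The shift by `e` puts `v₀` at height `1` in the half-space; the radius `1 / 2` below keeps
  -- points of `U` at distance less than `1`.
  set e : Euc 3 := consEquiv (0, 1) with he
  set χ : V × B → Euc 3 := fun v => L (v - v₀) + e with hχdef
  set σ : Euc 3 → V × B := fun y => L.symm (y - e) + v₀ with hσdef
  have hχ : ContDiff ℝ ∞ χ := (L.contDiff.comp (contDiff_id.sub contDiff_const)).add contDiff_const
  have hσ : ContDiff ℝ ∞ σ :=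
    (L.symm.contDiff.comp (contDiff_id.sub contDiff_const)).add contDiff_const
  have hσχ : ∀ v, σ (χ v) = v := fun v => by simp [hχdef, hσdef]
  have hχσ : ∀ y, χ (σ y) = y := fun v => by simp [hχdef, hσdef]
  set U : Set (V × B) := Metric.ball v₀ (1 / 2) ∩ {v | ‖v.1‖ < 1} ∩ {v | 0 < χ v 0} with hUdef
  have hU : IsOpen U := by
    refine (Metric.isOpen_ball.inter (isOpen_lt (by fun_prop) continuous_const)).inter
      (isOpen_lt continuous_const ?_)
    exact (EuclideanSpace.proj (𝕜 := ℝ) (0 : Fin 3)).continuous.comp hχ.continuous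
  have hχv₀ : χ v₀ 0 = 1 := by simp [hχdef, he]
  obtain ⟨h, hh, hsheet⟩ := exists_isSmoothChart (Γ := Γ) a hU (hU.preimage hσ.continuous)
    hχ.contDiffOn hσ.contDiffOn
    (fun v hv _ => ⟨by rwa [mem_preimage, hσχ], hv.2.le, hσχ v⟩)
    (fun y hy _ => ⟨hy, hy.1.2.le, hχσ y⟩)
    (fun v hv w hw _ _ => by
      have h1 := Metric.mem_ball.1 hv.1.1
      have h2 := Metric.mem_ball'.1 hw.1.1
      linarith [dist_triangle v v₀ w])
  have hmem : v₀ ∈ U :=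
    ⟨⟨Metric.mem_ball_self (by norm_num), hv₀⟩, by rw [mem_ofPred_eq, hχv₀]; exact one_pos⟩
  obtain ⟨h1, h2⟩ := hsheet v₀ hmem hv₀.le
  exact ⟨h, hh, h1, by rw [h2, hχv₀]; exact one_pos⟩

end TubeQuotient

/-! ### Boundary charts and the resulting manifold with boundary. -/

namespace TubeQuotient

/-- The radial projection to the boundary of the tube. -/
noncomputable def radial {V B : Type*} [NormedAddCommGroup V] [NormedSpace ℝ V] (v : V × B) :
    V × B :=
  (‖v.1‖⁻¹ • v.1, v.2)

theorem contDiffOn_radial {V B : Type*} [NormedAddCommGroup V] [InnerProductSpace ℝ V]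
    [NormedAddCommGroup B] [NormedSpace ℝ B] :
    ContDiffOn ℝ ∞ (radial (V := V) (B := B)) {v | 0 < ‖v.1‖} := by
  intro v hv
  have hv' : v.1 ≠ 0 := norm_pos_iff.1 hv
  refine ContDiffAt.contDiffWithinAt ?_
  exact (((contDiffAt_fst.norm ℝ hv').inv (norm_ne_zero_iff.2 hv')).smul contDiffAt_fst).prodMk
    contDiffAt_snd

theorem norm_radial_fst {V B : Type*} [NormedAddCommGroup V] [NormedSpace ℝ V] {v : V × B}
    (hv : 0 < ‖v.1‖) : ‖(radial v).1‖ = 1 := by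
  rw [radial, norm_smul, norm_inv, norm_norm, inv_mul_cancel₀ hv.ne']

theorem radial_eq_self {V B : Type*} [NormedAddCommGroup V] [NormedSpace ℝ V] {v : V × B}
    (hv : ‖v.1‖ = 1) : radial v = v := by
  rw [radial, hv, inv_one, one_smul]

theorem dist_radial {V B : Type*} [NormedAddCommGroup V] [NormedSpace ℝ V]
    [NormedAddCommGroup B] {v : V × B} (hv : 0 < ‖v.1‖) (hv' : ‖v.1‖ ≤ 1) :
    dist v (radial v) = 1 - ‖v.1‖ := by
  have h : v.1 - ‖v.1‖⁻¹ • v.1 = (1 - ‖v.1‖⁻¹) • v.1 := by rw [sub_smul, one_smul]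
  have h1 : 1 ≤ ‖v.1‖⁻¹ := (one_le_inv₀ hv).2 hv'
  rw [Prod.dist_eq, radial, dist_self, dist_eq_norm, h, norm_smul, Real.norm_eq_abs,
    abs_of_nonpos (by linarith), neg_sub, sub_mul, inv_mul_cancel₀ hv.ne', one_mul,
    max_eq_left (by linarith)]

variable {Γ V B : Type} {ι : Type u} [Group Γ]
    [NormedAddCommGroup V] [InnerProductSpace ℝ V] [NormedAddCommGroup B] [NormedSpace ℝ B]
    [MulAction Γ V] [MulAction Γ B] [MulAction Γ ι] [IsTubeAction Γ V B ι]

/-- A parametrisation of an open part of the boundary of the tube gives a chart with boundary. -/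
theorem exists_boundary_chart (a : ι) {T : Set (Euc 2)} {U₀ : Set (V × B)} (hT : IsOpen T)
    (hU₀ : IsOpen U₀) {k : Euc 2 → V × B} {s : V × B → Euc 2} (hk : ContDiffOn ℝ ∞ k T)
    (hs : ContDiffOn ℝ ∞ s U₀)
    (hkT : ∀ u ∈ T, ‖(k u).1‖ = 1 ∧ k u ∈ U₀ ∧ s (k u) = u)
    (hsU : ∀ v ∈ U₀, ‖v.1‖ = 1 → s v ∈ T ∧ k (s v) = v)
    (hdist : ∀ v ∈ U₀, ∀ w ∈ U₀, dist v w < 1 / 2) :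
    ∃ h : OpenPartialHomeomorph (TubeQuotient Γ V B ι) (EuclideanHalfSpace 3),
      IsSmoothChart h ∧ ∀ u ∈ T,
        sheet Γ a (k u) ∈ h.source ∧ (h (sheet Γ a (k u))).1 = consEquiv (u, 0) := by
  -- A collar with coordinates `(s (radial v), 1 - ‖v.1‖)`. Its points in the tube are within `1 /
  -- 4` of their radial projections, and these are within `1 / 2` of each other, so distances stay
  -- below `1`.
  set U : Set (V × B) := {v | 3 / 4 < ‖v.1‖} ∩ radial ⁻¹' U₀ with hUdef
  have hU34 : IsOpen {v : V × B | 3 / 4 < ‖v.1‖} := isOpen_lt continuous_const (by fun_prop)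
  have hsub : {v : V × B | 3 / 4 < ‖v.1‖} ⊆ {v | 0 < ‖v.1‖} := fun v (hv : 3 / 4 < ‖v.1‖) =>
    lt_trans (by norm_num) hv
  have hU : IsOpen U := (contDiffOn_radial.continuousOn.mono hsub).isOpen_inter_preimage hU34 hU₀
  set O : Set (Euc 3) := {y | |y 0| < 1 / 4 ∧ (consEquiv.symm y).1 ∈ T} with hOdef
  have hfst : Continuous fun y : Euc 3 => (consEquiv.symm y).1 :=
    continuous_fst.comp consEquiv.symm.continuous
  have hO : IsOpen O :=
    (isOpen_lt (EuclideanSpace.proj (𝕜 := ℝ) (0 : Fin 3)).continuous.abs continuous_const).inter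
      (hT.preimage hfst)
  have hχ : ContDiffOn ℝ ∞ (fun v : V × B => consEquiv (s (radial v), 1 - ‖v.1‖)) U := by
    refine consEquiv.contDiff.comp_contDiffOn (ContDiffOn.prodMk ?_ ?_)
    · exact hs.comp (contDiffOn_radial.mono fun v hv => hsub hv.1) fun v hv => hv.2
    · intro v hv
      exact (contDiffAt_const.sub
        (contDiffAt_fst.norm ℝ (norm_pos_iff.1 (hsub hv.1)))).contDiffWithinAt
  have hσ : ContDiffOn ℝ ∞ (fun y : Euc 3 => (((1 - y 0) • (k (consEquiv.symm y).1).1,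
      (k (consEquiv.symm y).1).2) : V × B)) O := by
    have h1 : ContDiffOn ℝ ∞ (fun y : Euc 3 => k (consEquiv.symm y).1) O :=
      hk.comp (contDiff_fst.comp consEquiv.symm.contDiff).contDiffOn fun y hy => hy.2
    have h2 : ContDiff ℝ ∞ fun y : Euc 3 => 1 - y 0 :=
      contDiff_const.sub (EuclideanSpace.proj (𝕜 := ℝ) (0 : Fin 3)).contDiff
    exact (h2.contDiffOn.smul h1.fst).prodMk h1.snd
  have hσnorm : ∀ y ∈ O, 0 ≤ y 0 → ‖(1 - y 0) • (k (consEquiv.symm y).1).1‖ = 1 - y 0 := by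
    intro y hy hy0
    have := (abs_lt.1 hy.1).2
    rw [norm_smul, (hkT _ hy.2).1, mul_one, Real.norm_of_nonneg (by linarith)]
  have hradσ : ∀ y ∈ O, 0 ≤ y 0 → radial (((1 - y 0) • (k (consEquiv.symm y).1).1,
      (k (consEquiv.symm y).1).2) : V × B) = k (consEquiv.symm y).1 := by
    intro y hy hy0
    have := (abs_lt.1 hy.1).2
    rw [radial, hσnorm y hy hy0]
    refine Prod.ext ?_ rfl
    exact inv_smul_smul₀ (by linarith) _
  obtain ⟨h, hh, hsheet⟩ : ∃ h : OpenPartialHomeomorph (TubeQuotient Γ V B ι) (EuclideanHalfSpace 3),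
      IsSmoothChart h ∧ ∀ v ∈ U, ‖v.1‖ ≤ 1 → sheet Γ a v ∈ h.source ∧
        (h (sheet Γ a v)).1 = consEquiv (s (radial v), 1 - ‖v.1‖) := by
    refine exists_isSmoothChart a hU hO hχ hσ ?_ ?_ ?_
    · rintro v ⟨hv, hv'⟩ hv1
      have hpos := hsub hv
      rw [mem_ofPred_eq] at hv hpos
      obtain ⟨h1, h2⟩ := hsU _ hv' (norm_radial_fst hpos)
      have h3 : consEquiv (s (radial v), 1 - ‖v.1‖) 0 = 1 - ‖v.1‖ := rfl
      refine ⟨⟨?_, ?_⟩, ?_, ?_⟩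
      · rw [h3, abs_of_nonneg (by linarith)]; linarith
      · rwa [ContinuousLinearEquiv.symm_apply_apply]
      · rw [h3]; linarith
      · simp only [h3, ContinuousLinearEquiv.symm_apply_apply, sub_sub_cancel, h2]
        exact Prod.ext (smul_inv_smul₀ hpos.ne' _) rfl
    · intro y hy hy0
      have := (abs_lt.1 hy.1).2
      refine ⟨⟨?_, ?_⟩, ?_, ?_⟩
      · rw [mem_ofPred_eq, hσnorm y hy hy0]; linarith
      · rw [mem_preimage, hradσ y hy hy0]; exact (hkT _ hy.2).2.1
      · rw [hσnorm y hy hy0]; linarith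
      · rw [hradσ y hy hy0, hσnorm y hy hy0, (hkT _ hy.2).2.2, sub_sub_cancel]
        exact consEquiv.apply_symm_apply y
    · rintro v ⟨hv, hv'⟩ w ⟨hw, hw'⟩ hv1 hw1
      have h1 := dist_radial (hsub hv) hv1
      have h2 := dist_radial (hsub hw) hw1
      have h3 := hdist _ hv' _ hw'
      rw [mem_ofPred_eq] at hv hw
      have h4 := dist_triangle4 v (radial v) (radial w) w
      rw [dist_comm (radial w) w] at h4
      linarith
  refine ⟨h, hh, fun u hu => ?_⟩
  obtain ⟨h1, h2, h3⟩ := hkT u hu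
  have hmem : k u ∈ U := ⟨by rw [mem_ofPred_eq, h1]; norm_num, by
    rwa [mem_preimage, radial_eq_self h1]⟩
  obtain ⟨h4, h5⟩ := hsheet _ hmem h1.le
  refine ⟨h4, ?_⟩
  rw [h5, radial_eq_self h1, h3, h1, sub_self]

/-- The smooth structure of a tube quotient, given charts which are adapted to a prospective
boundary `S`. -/
@[reducible]
noncomputable def chartedSpace {S : Set (TubeQuotient Γ V B ι)}
    (H : ∀ y, ∃ h : OpenPartialHomeomorph (TubeQuotient Γ V B ι) (EuclideanHalfSpace 3),
      IsSmoothChart h ∧ y ∈ h.source ∧ (y ∈ S ↔ 0 = (h y).1 0)) :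
    ChartedSpace (EuclideanHalfSpace 3) (TubeQuotient Γ V B ι) where
  atlas := {h | IsSmoothChart h}
  chartAt y := (H y).choose
  mem_chart_source y := (H y).choose_spec.2.1
  chart_mem_atlas y := (H y).choose_spec.1

section ChartedSpace

variable {S : Set (TubeQuotient Γ V B ι)}
    (H : ∀ y, ∃ h : OpenPartialHomeomorph (TubeQuotient Γ V B ι) (EuclideanHalfSpace 3),
      IsSmoothChart h ∧ y ∈ h.source ∧ (y ∈ S ↔ 0 = (h y).1 0))

theorem isManifold : letI := chartedSpace H; IsManifold (𝓡∂ 3) ∞ (TubeQuotient Γ V B ι) :=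
  let _ := chartedSpace H
  isManifold_of_contDiffOn _ _ _ fun _ _ he he' => IsSmoothChart.contDiffOn he he'

/-- A boundary point is recognised in the preferred chart at that point, and `H` selects one adapted
to `S`. -/
theorem boundary_eq : letI := chartedSpace H; (𝓡∂ 3).boundary (TubeQuotient Γ V B ι) = S := by
  let _ := chartedSpace H
  ext y
  change (extChartAt (𝓡∂ 3) y) y ∈ frontier (range (𝓡∂ 3)) ↔ y ∈ S
  rw [frontier_range_modelWithCornersEuclideanHalfSpace, (H y).choose_spec.2.2]
  rfl

theorem contMDiffOn_sheet (a : ι) : letI := chartedSpace H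
    ContMDiffOn 𝓘(ℝ, V × B) (𝓡∂ 3) ∞ (sheet Γ a) {v : V × B | ‖v.1‖ ≤ 1} := by
  let _ := chartedSpace H
  intro v hv
  rw [contMDiffWithinAt_iff_target]
  refine ⟨continuousOn_sheet a v hv, ContDiffWithinAt.contMDiffWithinAt ?_⟩
  exact (H (sheet Γ a v)).choose_spec.1.contDiffWithinAt_comp_sheet a v hv
    (H (sheet Γ a v)).choose_spec.2.1

/-- The chart followed by the local lift of its inverse. Such sections allow smoothness of maps on
the quotient to be tested on the sheets. -/
theorem exists_contMDiffAt_section (a : ι) {v : V × B} (hv : ‖v.1‖ ≤ 1) :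
    letI := chartedSpace H
    ∃ τ : TubeQuotient Γ V B ι → V × B, ContMDiffAt (𝓡∂ 3) 𝓘(ℝ, V × B) ∞ τ (sheet Γ a v) ∧
      τ (sheet Γ a v) = v ∧ ∀ᶠ y in 𝓝 (sheet Γ a v), ‖(τ y).1‖ ≤ 1 ∧ sheet Γ a (τ y) = y := by
  let _ := chartedSpace H
  set y₀ := sheet Γ a v with hy₀
  set h := (H y₀).choose with hh
  obtain ⟨hsm, hsrc, -⟩ := (H y₀).choose_spec
  obtain ⟨σ, hσ, hσv, hev⟩ := hsm.exists_section (h y₀) a v (h.map_source hsrc) hv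
    (by rw [h.left_inv hsrc])
  have hext : ContMDiffAt (𝓡∂ 3) 𝓘(ℝ, Euc 3) ∞ (extChartAt (𝓡∂ 3) y₀) y₀ := contMDiffAt_extChartAt
  have htends : Tendsto (fun y => (h y).1) (𝓝 y₀) (𝓝[range (𝓡∂ 3)] (h y₀).1) := by
    refine tendsto_nhdsWithin_iff.2 ⟨?_, Eventually.of_forall fun y => mem_range_self (h y)⟩
    exact continuous_subtype_val.continuousAt.comp (h.continuousAt hsrc)
  refine ⟨fun y => σ (h y).1, ?_, hσv, ?_⟩
  · exact contMDiffWithinAt_univ.1 (ContMDiffWithinAt.comp y₀ hσ.contMDiffWithinAt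
      (contMDiffWithinAt_univ.2 hext) fun y _ => mem_range_self (h y))
  · filter_upwards [htends.eventually hev, h.open_source.mem_nhds hsrc] with y hy hy2
    refine ⟨hy.1, hy.2.trans ?_⟩
    change h.symm ((𝓡∂ 3).symm ((𝓡∂ 3) (h y))) = y
    rw [(𝓡∂ 3).left_inv, h.left_inv hy2]

end ChartedSpace

end TubeQuotient

/-! ### The action of `G` on the quotient and the criterion for an equivariant filling. -/

namespace TubeQuotient

section Action

variable {Γ V B : Type} {ι : Type u} [Group Γ]
    [NormedAddCommGroup V] [NormedSpace ℝ V] [NormedAddCommGroup B] [NormedSpace ℝ B]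
    [MulAction Γ V] [MulAction Γ B] [MulAction Γ ι] [IsTubeAction Γ V B ι]
    {G : Type v} [Group G] [MulAction G ι] [SMulCommClass G Γ ι]

/-- Only the index moves, which descends because `G` and `Γ` commute on `ι`. The action need not be
free: a change of index may be undone by an element of `Γ` that fixes the point of the tube. -/
instance : SMul G (TubeQuotient Γ V B ι) where
  smul g := Quotient.map (sa := MulAction.orbitRel Γ (TubeSheets Γ V B ι))
    (sb := MulAction.orbitRel Γ (TubeSheets Γ V B ι))
    (fun x => sheetPoint Γ x.1 (g • x.2)) (by
      rintro _ x ⟨γ, rfl⟩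
      exact ⟨γ, Prod.ext rfl (smul_comm g γ x.2).symm⟩)

theorem smul_sheet (g : G) (a : ι) {v : V × B} (hv : ‖v.1‖ ≤ 1) :
    g • sheet Γ a v = sheet Γ (g • a) v := by
  rw [sheet_eq_mk a hv, sheet_eq_mk _ hv]
  rfl

instance : MulAction G (TubeQuotient Γ V B ι) where
  one_smul y := by
    obtain ⟨a, v, hv, rfl⟩ := exists_sheet_eq y
    rw [smul_sheet _ _ hv, one_smul]
  mul_smul g g' y := by
    obtain ⟨a, v, hv, rfl⟩ := exists_sheet_eq y
    rw [smul_sheet _ _ hv, smul_sheet _ _ hv, smul_sheet _ _ hv, mul_smul]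

end Action

variable {Γ V B : Type} {ι : Type u} [Group Γ]
    [NormedAddCommGroup V] [InnerProductSpace ℝ V] [NormedAddCommGroup B] [NormedSpace ℝ B]
    [MulAction Γ V] [MulAction Γ B] [MulAction Γ ι] [IsTubeAction Γ V B ι]

/-- A map on the quotient is smooth if it is smooth on all sheets. -/
theorem contMDiff_of_comp_sheet {S : Set (TubeQuotient Γ V B ι)}
    (H : ∀ y, ∃ h : OpenPartialHomeomorph (TubeQuotient Γ V B ι) (EuclideanHalfSpace 3),
      IsSmoothChart h ∧ y ∈ h.source ∧ (y ∈ S ↔ 0 = (h y).1 0))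
    {E' H' N : Type*} [NormedAddCommGroup E'] [NormedSpace ℝ E'] [TopologicalSpace H']
    [TopologicalSpace N] [ChartedSpace H' N] {J : ModelWithCorners ℝ E' H'}
    {f : TubeQuotient Γ V B ι → N}
    (hf : ∀ a : ι, ContMDiffOn 𝓘(ℝ, V × B) J ∞ (fun v => f (sheet Γ a v))
      {v : V × B | ‖v.1‖ ≤ 1}) :
    letI := chartedSpace H
    ContMDiff (𝓡∂ 3) J ∞ f := by
  let _ := chartedSpace H
  intro y
  obtain ⟨a, v, hv, rfl⟩ := exists_sheet_eq y
  obtain ⟨τ, hτ, hτv, hev⟩ := exists_contMDiffAt_section H a hv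
  have h1 : ContMDiffWithinAt (𝓡∂ 3) J ∞ ((fun v => f (sheet Γ a v)) ∘ τ)
      {y | ‖(τ y).1‖ ≤ 1} (sheet Γ a v) :=
    ContMDiffWithinAt.comp _ (by rw [hτv]; exact hf a v hv) hτ.contMDiffWithinAt fun _ hy => hy
  refine (h1.contMDiffAt (hev.mono fun _ h => h.1)).congr_of_eventuallyEq ?_
  filter_upwards [hev] with y hy
  exact congrArg f hy.2.symm

variable {G : Type v} [Group G] [MulAction G ι] [SMulCommClass G Γ ι]
    {Q : Type w} [TopologicalSpace Q] [ChartedSpace (Euc 2) Q] [IsManifold (𝓡 2) ∞ Q]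

/-- The map `i` from a surface to the quotient is, near `q₀`, a parametrisation of an open part
of the boundary of a sheet. -/
def IsBoundaryParametrisationAt (i : Q → TubeQuotient Γ V B ι) (q₀ : Q) : Prop :=
  ∃ (a : ι) (k : Q → V × B) (s : V × B → Q),
    (∀ᶠ q in 𝓝 q₀, ContMDiffAt (𝓡 2) 𝓘(ℝ, V × B) ∞ k q ∧ ‖(k q).1‖ = 1 ∧
      i q = sheet Γ a (k q) ∧ s (k q) = q) ∧
    ∀ᶠ v in 𝓝 (k q₀), ContMDiffAt 𝓘(ℝ, V × B) (𝓡 2) ∞ s v ∧ (‖v.1‖ = 1 → k (s v) = v)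

omit [IsManifold (𝓡 2) ∞ Q] in
theorem IsBoundaryParametrisationAt.continuousAt {i : Q → TubeQuotient Γ V B ι} {q₀ : Q}
    (h : IsBoundaryParametrisationAt i q₀) : ContinuousAt i q₀ := by
  obtain ⟨a, k, s, h1, -⟩ := h
  have hk := h1.self_of_nhds.1.continuousAt
  have h2 : ContinuousAt (fun q => sheet Γ a (k q)) q₀ :=
    (continuousOn_sheet (Γ := Γ) a (k q₀) h1.self_of_nhds.2.1.le).tendsto.comp
      (tendsto_nhdsWithin_iff.2 ⟨hk, h1.mono fun q hq => hq.2.1.le⟩)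
  exact h2.congr (h1.mono fun q hq => hq.2.2.1.symm)

/-- Reading `k` and `s` in the chart of `Q` at `q₀` reduces this to `exists_boundary_chart`. In the
new chart `i` is linear with vanishing normal coordinate, which gives both the adaptation to the
boundary and the normal form of an immersion. -/
theorem IsBoundaryParametrisationAt.exists_chart {i : Q → TubeQuotient Γ V B ι} {q₀ : Q}
    (h : IsBoundaryParametrisationAt i q₀) :
    ∃ (Q' : Set Q) (h : OpenPartialHomeomorph (TubeQuotient Γ V B ι) (EuclideanHalfSpace 3)),
      IsOpen Q' ∧ q₀ ∈ Q' ∧ Q' ⊆ (chartAt (Euc 2) q₀).source ∧ IsSmoothChart h ∧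
      ∀ q ∈ Q', i q ∈ h.source ∧ (h (i q)).1 = consEquiv (chartAt (Euc 2) q₀ q, 0) := by
  obtain ⟨a, k, s, h1, h2⟩ := h
  set φ := chartAt (Euc 2) q₀ with hφ
  obtain ⟨Q₁, hQ₁, hQ₁o, hq₀⟩ := eventually_nhds_iff.1 h1
  obtain ⟨U₁, hU₁, hU₁o, hv₀⟩ := eventually_nhds_iff.1 h2
  have hkQ : ContMDiffOn (𝓡 2) 𝓘(ℝ, V × B) ∞ k Q₁ := fun q hq => (hQ₁ q hq).1.contMDiffWithinAt
  have hsU : ContMDiffOn 𝓘(ℝ, V × B) (𝓡 2) ∞ s U₁ := fun v hv => (hU₁ v hv).1.contMDiffWithinAt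
  -- The radius `1 / 4` yields the distance bound `1 / 2` of `exists_boundary_chart`.
  set U₀ : Set (V × B) := (U₁ ∩ s ⁻¹' (Q₁ ∩ φ.source)) ∩ Metric.ball (k q₀) (1 / 4) with hU₀
  have hU₀o : IsOpen U₀ :=
    (hsU.continuousOn.isOpen_inter_preimage hU₁o (hQ₁o.inter φ.open_source)).inter
      Metric.isOpen_ball
  set Q₂ : Set Q := (Q₁ ∩ φ.source) ∩ k ⁻¹' U₀ with hQ₂
  have hQ₂o : IsOpen Q₂ := (hkQ.continuousOn.mono inter_subset_left).isOpen_inter_preimage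
    (hQ₁o.inter φ.open_source) hU₀o
  have hQ₂φ : Q₂ ⊆ φ.source := fun q hq => hq.1.2
  have hq₀' : q₀ ∈ Q₂ := by
    refine ⟨⟨hq₀, mem_chart_source _ q₀⟩, ⟨hv₀, ?_⟩, Metric.mem_ball_self (by norm_num)⟩
    rw [mem_preimage, (hQ₁ q₀ hq₀).2.2.2]
    exact ⟨hq₀, mem_chart_source _ q₀⟩
  have hT : IsOpen (φ '' Q₂) := φ.isOpen_image_of_subset_source hQ₂o hQ₂φ
  have hk' : ContDiffOn ℝ ∞ (k ∘ φ.symm) (φ '' Q₂) := by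
    rw [← contMDiffOn_iff_contDiffOn]
    refine hkQ.comp ((contMDiffOn_chart_symm (I := 𝓡 2) (x := q₀)).mono ?_) ?_
    · rintro _ ⟨q, hq, rfl⟩
      exact φ.map_source (hQ₂φ hq)
    · rintro _ ⟨q, hq, rfl⟩
      rw [mem_preimage, φ.left_inv (hQ₂φ hq)]
      exact hq.1.1
  have hs' : ContDiffOn ℝ ∞ (φ ∘ s) U₀ := by
    rw [← contMDiffOn_iff_contDiffOn]
    exact (contMDiffOn_chart (I := 𝓡 2) (x := q₀)).comp (hsU.mono fun v hv => hv.1.1)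
      fun v hv => hv.1.2.2
  obtain ⟨h, hh, hk⟩ : ∃ h : OpenPartialHomeomorph (TubeQuotient Γ V B ι) (EuclideanHalfSpace 3),
      IsSmoothChart h ∧ ∀ u ∈ φ '' Q₂, sheet Γ a ((k ∘ φ.symm) u) ∈ h.source ∧
        (h (sheet Γ a ((k ∘ φ.symm) u))).1 = consEquiv (u, 0) := by
    refine exists_boundary_chart a hT hU₀o hk' hs' ?_ ?_ ?_
    · rintro _ ⟨q, hq, rfl⟩
      obtain ⟨-, h3, -, h5⟩ := hQ₁ q hq.1.1
      simp only [Function.comp_apply, φ.left_inv (hQ₂φ hq)]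
      exact ⟨h3, hq.2, by rw [h5]⟩
    · intro v hv hv1
      have h3 := (hU₁ v hv.1.1).2 hv1
      refine ⟨⟨s v, ⟨hv.1.2, by rwa [mem_preimage, h3]⟩, rfl⟩, ?_⟩
      simp only [Function.comp_apply, φ.left_inv hv.1.2.2, h3]
    · intro v hv w hw
      have h3 := Metric.mem_ball.1 hv.2
      have h4 := Metric.mem_ball'.1 hw.2
      linarith [dist_triangle v (k q₀) w]
  refine ⟨Q₂, h, hQ₂o, hq₀', hQ₂φ, hh, fun q hq => ?_⟩
  have h3 := hk (φ q) ⟨q, hq, rfl⟩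
  rw [Function.comp_apply, φ.left_inv (hQ₂φ hq), ← (hQ₁ q hq.1.1).2.2.1] at h3
  exact h3

/-- If a surface parametrises the boundary of the tubes, the quotient has adapted charts. -/
theorem exists_adapted_chart (L : (V × B) ≃L[ℝ] Euc 3) {i : Q → TubeQuotient Γ V B ι}
    (hi : ∀ q, IsBoundaryParametrisationAt i q)
    (hrange : ∀ (a : ι) (v : V × B), ‖v.1‖ = 1 → sheet Γ a v ∈ range i)
    (y : TubeQuotient Γ V B ι) :
    ∃ h : OpenPartialHomeomorph (TubeQuotient Γ V B ι) (EuclideanHalfSpace 3),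
      IsSmoothChart h ∧ y ∈ h.source ∧ (y ∈ range i ↔ 0 = (h y).1 0) := by
  by_cases hy : y ∈ range i
  · obtain ⟨q, rfl⟩ := hy
    obtain ⟨Q', h, -, hq, -, hh, h1⟩ := (hi q).exists_chart
    refine ⟨h, hh, (h1 q hq).1, iff_of_true (mem_range_self q) ?_⟩
    rw [(h1 q hq).2, consEquiv_apply_zero]
  · obtain ⟨a, v, hv, rfl⟩ := exists_sheet_eq y
    obtain ⟨h, hh, h1, h2⟩ := exists_interior_chart (Γ := Γ) L a
      (lt_of_le_of_ne hv fun h => hy (hrange a v h))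
    exact ⟨h, hh, h1, iff_of_false hy h2.ne⟩

/-- On the sheet `a` the action of `g` is the smooth map `sheet Γ (g • a)`. The map `i` is a
topological embedding as a continuous injection from a compact to a Hausdorff space, and an
immersion by the charts of `exists_chart`. -/
theorem isEquivariantFilling [CompactSpace Q] [MulAction G Q] [Finite ι]
    {K : Set (V × B)} (hK : IsCompact K) (hK1 : K ⊆ {v | ‖v.1‖ ≤ 1})
    (hK2 : ∀ v : V × B, ‖v.1‖ ≤ 1 → ∃ γ : Γ, γ • v ∈ K)
    {i : Q → TubeQuotient Γ V B ι} (hi : ∀ q, IsBoundaryParametrisationAt i q)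
    (hinj : Function.Injective i) (hsmul : ∀ (g : G) (q : Q), i (g • q) = g • i q)
    (H : ∀ y, ∃ h : OpenPartialHomeomorph (TubeQuotient Γ V B ι) (EuclideanHalfSpace 3),
      IsSmoothChart h ∧ y ∈ h.source ∧ (y ∈ range i ↔ 0 = (h y).1 0)) :
    letI := chartedSpace H
    IsEquivariantFilling G i := by
  let _ := chartedSpace H
  have hman : IsManifold (𝓡∂ 3) ∞ (TubeQuotient Γ V B ι) := isManifold H
  have hcont : Continuous i := continuous_iff_continuousAt.2 fun q => (hi q).continuousAt
  refine ⟨hman, inferInstance, compactSpace hK hK1 hK2, fun g => ?_, ⟨⟨ℝ, inferInstance,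
    inferInstance, fun q => ?_⟩, (hcont.isClosedEmbedding hinj).isEmbedding⟩,
    (boundary_eq H).symm, hsmul⟩
  · refine contMDiff_of_comp_sheet H fun a => ?_
    exact (contMDiffOn_sheet H (g • a)).congr fun v hv => smul_sheet g a hv
  · obtain ⟨Q', h, hQ', hq, hQ's, hh, h1⟩ := (hi q).exists_chart
    have hsrc : ((chartAt (Euc 2) q).restr Q').source = Q' := by
      rw [OpenPartialHomeomorph.restr_source' _ _ hQ', inter_eq_right.2 hQ's]
    refine Manifold.IsImmersionAtOfComplement.mk_of_charts consEquiv
      ((chartAt (Euc 2) q).restr Q') h (by rwa [hsrc]) (h1 q hq).1 ?_ ?_ ?_ ?_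
    · exact restr_mem_maximalAtlas _ (IsManifold.chart_mem_maximalAtlas q) hQ'
    · exact IsManifold.subset_maximalAtlas hh
    · rw [hsrc]
      exact fun q' hq' => (h1 q' hq').1
    · intro u hu
      have hu' := ((chartAt (Euc 2) q).restr Q').map_target (x := u) (by simpa using hu)
      rw [hsrc] at hu'
      change (h (i (((chartAt (Euc 2) q).restr Q').symm u))).1 = consEquiv (u, 0)
      rw [(h1 _ hu').2]
      congr 2
      exact ((chartAt (Euc 2) q).restr Q').right_inv (by simpa using hu)

end TubeQuotient

/-! ### Lifts to a principal bundle -/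

/-- The continuous lifts of `f : S → M` to `Q`. -/
@[ext]
structure BundleLift {S : Type} {Q : Type u} {M : Type w} [TopologicalSpace S]
    [TopologicalSpace Q] (p : Q → M) (f : S → M) : Type u where
  /-- The underlying map. -/
  toFun : S → Q
  continuous_toFun : Continuous toFun
  apply_toFun (a : S) : p (toFun a) = f a

instance {S : Type} {Q : Type u} {M : Type w} [TopologicalSpace S]
    [TopologicalSpace Q] (p : Q → M) (f : S → M) : CoeFun (BundleLift p f) fun _ => S → Q :=
  ⟨BundleLift.toFun⟩

/-- An action of a group by homeomorphisms on the domain of `f` whose orbits are the fibres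
of `f`. -/
class IsDeckAction (Γ : Type) {S : Type} {M : Type w} [Group Γ] [TopologicalSpace S]
    [MulAction Γ S] (f : S → M) : Prop where
  continuous_smul (γ : Γ) : Continuous fun a : S => γ • a
  apply_smul (γ : Γ) (a : S) : f (γ • a) = f a
  exists_smul_eq (a b : S) : f a = f b → ∃ γ : Γ, γ • a = b

/-- A smooth map from `S` onto the boundary of the tube which admits smooth local sections. -/
structure IsTubeBoundary {S V B : Type} [TopologicalSpace S] [ChartedSpace (Euc 2) S]
    [NormedAddCommGroup V] [NormedSpace ℝ V] [NormedAddCommGroup B] [NormedSpace ℝ B]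
    (j : S → V × B) : Prop where
  contMDiff : ContMDiff (𝓡 2) 𝓘(ℝ, V × B) ∞ j
  norm_fst (a : S) : ‖(j a).1‖ = 1
  exists_apply_eq (v : V × B) : ‖v.1‖ = 1 → ∃ a, j a = v
  exists_section (a₀ : S) : ∃ s : V × B → S, (∀ᶠ a in 𝓝 a₀, s (j a) = a) ∧
    ∀ᶠ v in 𝓝 (j a₀), ContMDiffAt 𝓘(ℝ, V × B) (𝓡 2) ∞ s v ∧ (‖v.1‖ = 1 → j (s v) = v)

namespace BundleLift

variable {G : Type v} [Group G] {S : Type} {Q : Type u} {M : Type w}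
    [TopologicalSpace S] [ChartedSpace (Euc 2) S]
    [TopologicalSpace Q] [ChartedSpace (Euc 2) Q]
    [TopologicalSpace M] [ChartedSpace (Euc 2) M] [MulAction G Q] {p : Q → M} {f : S → M}

/-- The inverse makes the evaluation `(a, F) ↦ F a` invariant under the diagonal action of `Γ`. -/
instance {Γ : Type} [Group Γ] [MulAction Γ S] [IsDeckAction Γ f] : MulAction Γ (BundleLift p f) where
  smul γ F := ⟨fun a => F (γ⁻¹ • a),
    F.continuous_toFun.comp (IsDeckAction.continuous_smul f γ⁻¹), fun a => by
      rw [F.apply_toFun]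
      exact IsDeckAction.apply_smul γ⁻¹ a⟩
  one_smul F := BundleLift.ext <| funext fun a => by
    change F ((1 : Γ)⁻¹ • a) = F a
    rw [inv_one, one_smul]
  mul_smul γ δ F := BundleLift.ext <| funext fun a => by
    change F ((γ * δ)⁻¹ • a) = F (δ⁻¹ • γ⁻¹ • a)
    rw [mul_inv_rev, mul_smul]

omit [ChartedSpace (Euc 2) S] [ChartedSpace (Euc 2) Q] [TopologicalSpace M]
    [ChartedSpace (Euc 2) M] in
theorem smul_apply {Γ : Type} [Group Γ] [MulAction Γ S] [IsDeckAction Γ f] (γ : Γ)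
    (F : BundleLift p f) (a : S) : (γ • F) a = F (γ⁻¹ • a) := rfl

omit [ChartedSpace (Euc 2) S] [ChartedSpace (Euc 2) Q] [TopologicalSpace M]
    [ChartedSpace (Euc 2) M] in
theorem smul_apply_smul {Γ : Type} [Group Γ] [MulAction Γ S] [IsDeckAction Γ f] (γ : Γ)
    (F : BundleLift p f) (a : S) : (γ • F) (γ • a) = F a := by
  rw [smul_apply, inv_smul_smul]

instance [hp : Fact (IsPrincipalBundle G p)] : MulAction G (BundleLift p f) where
  smul g F := ⟨fun a => g • F a,
    (hp.out.contMDiff_smul g).continuous.comp F.continuous_toFun, fun a => by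
      rw [hp.out.isQuotientCoveringMap.map_smul, F.apply_toFun]⟩
  one_smul F := BundleLift.ext <| funext fun a => one_smul G (F a)
  mul_smul g g' F := BundleLift.ext <| funext fun a => mul_smul g g' (F a)

omit [ChartedSpace (Euc 2) S] in
theorem smul_apply' [Fact (IsPrincipalBundle G p)] (g : G) (F : BundleLift p f) (a : S) :
    (g • F) a = g • F a := rfl

instance {Γ : Type} [Group Γ] [MulAction Γ S] [IsDeckAction Γ f]
    [Fact (IsPrincipalBundle G p)] : SMulCommClass G Γ (BundleLift p f) :=
  ⟨fun _ _ _ => rfl⟩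

omit [ChartedSpace (Euc 2) S] in
theorem eq_of_apply_eq [PreconnectedSpace S] (hp : IsPrincipalBundle G p)
    {F F' : BundleLift p f} {a : S} (h : F a = F' a) : F = F' :=
  BundleLift.ext <| hp.isQuotientCoveringMap.isCoveringMap.eq_of_comp_eq F.continuous_toFun
    F'.continuous_toFun (funext fun b => (F.apply_toFun b).trans (F'.apply_toFun b).symm) a h

-- The fibres of `p` are orbits and a lift is determined by one value. With `smul_left_injective`,
-- the lifts form a `G`-torsor whenever one exists.
omit [ChartedSpace (Euc 2) S] in
theorem exists_smul_eq [PreconnectedSpace S] [Nonempty S] [hp : Fact (IsPrincipalBundle G p)]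
    (F F' : BundleLift p f) : ∃ g : G, g • F = F' := by
  obtain ⟨a⟩ := ‹Nonempty S›
  obtain ⟨g, hg⟩ := hp.out.isQuotientCoveringMap.apply_eq_iff_mem_orbit.1
    ((F'.apply_toFun a).trans (F.apply_toFun a).symm)
  exact ⟨g, eq_of_apply_eq hp.out (a := a) hg⟩

omit [ChartedSpace (Euc 2) S] in
theorem smul_left_injective [Nonempty S] [hp : Fact (IsPrincipalBundle G p)]
    (F : BundleLift p f) {g g' : G} (h : g • F = g' • F) : g = g' := by
  obtain ⟨a⟩ := ‹Nonempty S›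
  have := hp.out.isQuotientCoveringMap.isCancelSMul
  exact IsCancelSMul.right_cancel g g' (F a) (congrArg (fun F' : BundleLift p f => F' a) h)

omit [ChartedSpace (Euc 2) S] in
theorem finite [Finite G] [PreconnectedSpace S] [Nonempty S] (hp : IsPrincipalBundle G p) :
    Finite (BundleLift p f) := by
  have : Fact (IsPrincipalBundle G p) := ⟨hp⟩
  rcases isEmpty_or_nonempty (BundleLift p f) with _ | ⟨⟨F⟩⟩
  · infer_instance
  · exact Finite.of_surjective (fun g : G => g • F) fun F' => exists_smul_eq F F'

/-- Near any point, `F` is a smooth local inverse of `p` composed with `f`. -/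
theorem contMDiff (hp : IsPrincipalBundle G p) (hf : IsLocalDiffeomorph (𝓡 2) (𝓡 2) ∞ f)
    (F : BundleLift p f) : ContMDiff (𝓡 2) (𝓡 2) ∞ F := by
  intro a
  have hpF := hp.isLocalDiffeomorph (F a)
  have h1 : ContMDiffAt (𝓡 2) (𝓡 2) ∞ (hpF.localInverse ∘ f) a := by
    refine ContMDiffAt.comp a ?_ (hf a).contMDiffAt
    rw [← F.apply_toFun]
    exact hpF.localInverse_contMDiffAt
  refine h1.congr_of_eventuallyEq ?_
  filter_upwards [F.continuous_toFun.continuousAt.eventually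
    hpF.localInverse_eventuallyEq_left] with b hb
  rw [Function.comp_apply, ← F.apply_toFun]
  exact hb.symm

/-- A lift of a local diffeomorphism has smooth local inverses. -/
theorem exists_local_inverse (hp : IsPrincipalBundle G p)
    (hf : IsLocalDiffeomorph (𝓡 2) (𝓡 2) ∞ f) (F : BundleLift p f) (a : S) :
    ∃ l : Q → S, l (F a) = a ∧ (∀ᶠ q in 𝓝 (F a), ContMDiffAt (𝓡 2) (𝓡 2) ∞ l q ∧ F (l q) = q) ∧
      ∀ᶠ b in 𝓝 a, l (F b) = b := by
  have hpF := hp.isLocalDiffeomorph (F a)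
  have hpc : ContMDiff (𝓡 2) (𝓡 2) ∞ p := hp.isLocalDiffeomorph.contMDiff
  set l : Q → S := fun q => (hf a).localInverse (p q) with hl
  have hlF : ∀ᶠ b in 𝓝 a, l (F b) = b := by
    filter_upwards [(hf a).localInverse_eventuallyEq_left] with b hb
    rw [hl]
    simp only [F.apply_toFun]
    exact hb
  have hsrc : ∀ᶠ q in 𝓝 (F a), p q ∈ (hf a).localInverse.source :=
    hpc.continuous.continuousAt.eventually_mem <| by
      rw [F.apply_toFun]
      exact (hf a).localInverse_open_source.mem_nhds (hf a).localInverse_mem_source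
  have hsm : ∀ᶠ q in 𝓝 (F a), ContMDiffAt (𝓡 2) (𝓡 2) ∞ l q := by
    filter_upwards [hsrc] with q hq
    exact ContMDiffAt.comp q ((hf a).localInverse_contMDiffOn.contMDiffAt
      ((hf a).localInverse_open_source.mem_nhds hq)) (hpc q)
  have hla : l (F a) = a := hlF.self_of_nhds
  -- Continuity brings `F (l q)` back to where `p` is inverted; since `q` and `F (l q)` have the
  -- same image under `p`, they coincide.
  have hFl : Tendsto (fun q => F (l q)) (𝓝 (F a)) (𝓝 (F a)) := by
    have h1 : ContinuousAt (fun q => F (l q)) (F a) :=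
      F.continuous_toFun.continuousAt.comp hsm.self_of_nhds.continuousAt
    have h2 := h1.tendsto
    simp only [hla] at h2
    exact h2
  refine ⟨l, hla, ?_, hlF⟩
  filter_upwards [hsm, hsrc, hpF.localInverse_eventuallyEq_left,
    hFl.eventually hpF.localInverse_eventuallyEq_left] with q h1 h2 h3 h4
  refine ⟨h1, ?_⟩
  rw [Function.comp_apply, id_eq] at h3 h4
  have h5 : f (l q) = p q := (hf a).localInverse_right_inv h2
  rw [F.apply_toFun, h5] at h4
  exact h4.symm.trans h3

/-! ### The identification of the total space with the boundary of the tube quotient. -/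

section Filling

variable {Γ V B : Type} [Group Γ] [NormedAddCommGroup V] [InnerProductSpace ℝ V]
    [NormedAddCommGroup B] [NormedSpace ℝ B] [MulAction Γ V] [MulAction Γ B]
    [MulAction Γ S] [IsDeckAction Γ f] [IsTubeAction Γ V B (BundleLift p f)]

open TubeQuotient

variable (Γ) in
open Classical in
/-- The map `F a ↦ [j a, F]` from the total space to the tube quotient. -/
noncomputable def boundaryMap (p : Q → M) (f : S → M) [IsDeckAction Γ f]
    [IsTubeAction Γ V B (BundleLift p f)] (j : S → V × B) (F₀ : BundleLift p f) (q : Q) :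
    TubeQuotient Γ V B (BundleLift p f) :=
  if h : ∃ x : BundleLift p f × S, x.1 x.2 = q then sheet Γ h.choose.1 (j h.choose.2)
  else sheet Γ F₀ 0

variable [PreconnectedSpace S] {j : S → V × B} (hj : IsTubeBoundary j)
    (hjΓ : ∀ (γ : Γ) (a : S), j (γ • a) = γ • j a) (F₀ : BundleLift p f)

-- The choice of a representation `q = F' a'` does not matter: two of them lie over the same point
-- of `M`, hence differ by some `γ`, which carries `F'` to `F` by uniqueness of lifts.
include hj hjΓ in
theorem boundaryMap_apply (hp : IsPrincipalBundle G p) (F : BundleLift p f) (a : S) :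
    boundaryMap Γ p f j F₀ (F a) = sheet Γ F (j a) := by
  have h : ∃ x : BundleLift p f × S, x.1 x.2 = F a := ⟨(F, a), rfl⟩
  rw [boundaryMap, dif_pos h]
  have h1 := h.choose_spec
  set F' := h.choose.1
  set a' := h.choose.2
  have h2 : f a' = f a := by rw [← F'.apply_toFun, ← F.apply_toFun, h1]
  obtain ⟨γ, hγ⟩ := IsDeckAction.exists_smul_eq (Γ := Γ) a' a h2
  have h3 : γ • F' = F := by
    refine eq_of_apply_eq hp (a := a) ?_
    rw [← h1, ← hγ, smul_apply_smul]
  rw [← h3, ← hγ, hjΓ, sheet_smul γ F' (hj.norm_fst a').le]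

-- Points with the same image are matched by some `γ` only up to equality under `j`, which is not
-- injective on the plane; `hjF` says that the lifts factor through `j`.
include hj hjΓ in
theorem boundaryMap_injective (hp : IsPrincipalBundle G p)
    (hlift : ∀ q : Q, ∃ (F : BundleLift p f) (a : S), F a = q)
    (hjF : ∀ (F : BundleLift p f) (a b : S), j a = j b → F a = F b) :
    Function.Injective (boundaryMap Γ p f j F₀) := by
  intro q q' h
  obtain ⟨F, a, rfl⟩ := hlift q
  obtain ⟨F', a', rfl⟩ := hlift q'
  rw [boundaryMap_apply hj hjΓ F₀ hp, boundaryMap_apply hj hjΓ F₀ hp] at h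
  obtain ⟨γ, h1, h2⟩ := (sheet_eq_sheet_iff (hj.norm_fst a).le (hj.norm_fst a').le).1 h
  rw [← hjΓ] at h1
  rw [← hjF F' _ _ h1, ← h2, smul_apply_smul]

include hj hjΓ in
theorem boundaryMap_smul [hp : Fact (IsPrincipalBundle G p)]
    (hlift : ∀ q : Q, ∃ (F : BundleLift p f) (a : S), F a = q) (g : G) (q : Q) :
    boundaryMap Γ p f j F₀ (g • q) = g • boundaryMap Γ p f j F₀ q := by
  obtain ⟨F, a, rfl⟩ := hlift q
  rw [← smul_apply', boundaryMap_apply hj hjΓ F₀ hp.out, boundaryMap_apply hj hjΓ F₀ hp.out,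
    smul_sheet g F (hj.norm_fst a).le]

include hj hjΓ in
theorem sheet_mem_range_boundaryMap (hp : IsPrincipalBundle G p) (F : BundleLift p f) {v : V × B}
    (hv : ‖v.1‖ = 1) : sheet Γ F v ∈ range (boundaryMap Γ p f j F₀) := by
  obtain ⟨a, rfl⟩ := hj.exists_apply_eq v hv
  exact ⟨F a, boundaryMap_apply hj hjΓ F₀ hp F a⟩

include hj hjΓ in
theorem isBoundaryParametrisationAt_boundaryMap (hp : IsPrincipalBundle G p)
    (hf : IsLocalDiffeomorph (𝓡 2) (𝓡 2) ∞ f)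
    (hlift : ∀ q : Q, ∃ (F : BundleLift p f) (a : S), F a = q) (q : Q) :
    IsBoundaryParametrisationAt (boundaryMap Γ p f j F₀) q := by
  obtain ⟨F, a, rfl⟩ := hlift q
  obtain ⟨l, hla, hl, hlF⟩ := F.exists_local_inverse hp hf a
  obtain ⟨s, hsj, hs⟩ := hj.exists_section a
  have hlc : Tendsto l (𝓝 (F a)) (𝓝 a) := by
    have h := hl.self_of_nhds.1.continuousAt.tendsto
    rwa [hla] at h
  have hsc : Tendsto s (𝓝 (j a)) (𝓝 a) := by
    have h := hs.self_of_nhds.1.continuousAt.tendsto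
    rwa [hsj.self_of_nhds] at h
  -- The sheet of `F` is parametrised by `j` after the local inverse of `F`, and inverted by `F`
  -- after the local section of `j`.
  refine ⟨F, fun q => j (l q), fun v => F (s v), ?_, ?_⟩
  · filter_upwards [hl, hlc.eventually hsj] with q hq hq'
    refine ⟨hj.contMDiff.contMDiffAt.comp q hq.1, hj.norm_fst _, ?_, ?_⟩
    · rw [← boundaryMap_apply hj hjΓ F₀ hp, hq.2]
    · rw [hq', hq.2]
  · simp only [hla]
    filter_upwards [hs, hsc.eventually hlF] with v hv hv'
    refine ⟨((F.contMDiff hp hf).contMDiffAt).comp v hv.1, fun h => ?_⟩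
    rw [hv', hv.2 h]

end Filling

end BundleLift

/-! ### Bundles over the torus and the Klein bottle -/

/-- The group of all `(s, t) ↦ (s + m, ε ^ m t + n)`, where the parameter `N` records its action
on the solid cylinder by rotations through multiples of `2π / N`. -/
@[ext]
structure FlatGroup (ε : ℤˣ) (N : ℕ) : Type where
  /-- The translation part in the first direction. -/
  m : ℤ
  /-- The translation part in the second direction. -/
  n : ℤ

/-- The identity of `ℂ` or the complex conjugation, depending on a sign. -/
noncomputable def signConj (u : ℤˣ) : ℂ → ℂ := if u = 1 then id else starRingEnd ℂ

theorem signConj_one (z : ℂ) : signConj 1 z = z := by simp [signConj]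

theorem signConj_neg_one (z : ℂ) : signConj (-1) z = starRingEnd ℂ z := by
  simp [signConj, show ¬ ((-1 : ℤˣ) = 1) by decide]

theorem signConj_mul (u : ℤˣ) (z w : ℂ) : signConj u (z * w) = signConj u z * signConj u w := by
  rcases Int.units_eq_one_or u with rfl | rfl
  · simp only [signConj_one]
  · simp only [signConj_neg_one, map_mul]

theorem signConj_sub (u : ℤˣ) (z w : ℂ) : signConj u (z - w) = signConj u z - signConj u w := by
  rcases Int.units_eq_one_or u with rfl | rfl
  · simp only [signConj_one]
  · simp only [signConj_neg_one, map_sub]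

theorem signConj_signConj (u u' : ℤˣ) (z : ℂ) :
    signConj u (signConj u' z) = signConj (u * u') z := by
  rcases Int.units_eq_one_or u with rfl | rfl
  · rw [signConj_one, one_mul]
  · rcases Int.units_eq_one_or u' with rfl | rfl
    · rw [signConj_one, mul_one]
    · rw [signConj_neg_one, signConj_neg_one, Complex.conj_conj, neg_mul_neg, one_mul, signConj_one]

theorem norm_signConj (u : ℤˣ) (z : ℂ) : ‖signConj u z‖ = ‖z‖ := by
  rcases Int.units_eq_one_or u with rfl | rfl
  · rw [signConj_one]
  · rw [signConj_neg_one, RCLike.norm_conj]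

theorem contDiff_signConj (u : ℤˣ) : ContDiff ℝ ∞ (signConj u) := by
  rcases Int.units_eq_one_or u with rfl | rfl
  · rw [show signConj 1 = id from funext signConj_one]
    exact contDiff_id
  · rw [show signConj (-1) = Complex.conjCLE from funext signConj_neg_one]
    exact Complex.conjCLE.contDiff

/-- The point of the unit circle at `t / N` turns. -/
noncomputable def turn (N : ℕ) (t : ℝ) : ℂ := Complex.exp (((2 * Real.pi / N * t : ℝ) : ℂ) * Complex.I)

theorem turn_add (N : ℕ) (s t : ℝ) : turn N (s + t) = turn N s * turn N t := by
  rw [turn, turn, turn, ← Complex.exp_add, ← add_mul, ← Complex.ofReal_add, ← mul_add]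

theorem norm_turn (N : ℕ) (t : ℝ) : ‖turn N t‖ = 1 := Complex.norm_exp_ofReal_mul_I _

theorem turn_zero (N : ℕ) : turn N 0 = 1 := by simp [turn]

theorem signConj_turn (u : ℤˣ) (N : ℕ) (t : ℝ) :
    signConj u (turn N t) = turn N (((u : ℤ) : ℝ) * t) := by
  rcases Int.units_eq_one_or u with rfl | rfl
  · rw [signConj_one, Units.val_one, Int.cast_one, one_mul]
  · rw [signConj_neg_one, turn, turn, ← Complex.exp_conj, map_mul, Complex.conj_ofReal,
      Complex.conj_I]
    congr 1
    push_cast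
    ring

theorem turn_eq_turn_iff {N : ℕ} (hN : 0 < N) {s t : ℝ} :
    turn N s = turn N t ↔ ∃ k : ℤ, s = t + k * N := by
  have hN' : (N : ℂ) ≠ 0 := Nat.cast_ne_zero.2 hN.ne'
  rw [turn, turn, Complex.exp_eq_exp_iff_exists_int]
  refine exists_congr fun k => ?_
  have hpi : (Real.pi : ℂ) ≠ 0 := Complex.ofReal_ne_zero.2 Real.pi_ne_zero
  have hI := Complex.I_ne_zero
  constructor
  · intro h
    have h1 : (s : ℂ) = t + k * N := by
      push_cast at h
      field_simp at h
      linear_combination h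
    exact_mod_cast h1
  · intro h
    rw [h]
    push_cast
    field_simp

theorem contDiff_turn (N : ℕ) : ContDiff ℝ ∞ (turn N) := by
  refine Complex.contDiff_exp.comp (ContDiff.mul ?_ contDiff_const)
  exact Complex.ofRealCLM.contDiff.comp (contDiff_const.mul contDiff_id)

namespace FlatGroup

variable {ε : ℤˣ} {N : ℕ}

instance : Mul (FlatGroup ε N) := ⟨fun x y => ⟨x.m + y.m, x.n + (ε ^ x.m : ℤˣ) * y.n⟩⟩

instance : One (FlatGroup ε N) := ⟨⟨0, 0⟩⟩

instance : Inv (FlatGroup ε N) := ⟨fun x => ⟨-x.m, -((ε ^ (-x.m) : ℤˣ) * x.n)⟩⟩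

theorem mul_m (x y : FlatGroup ε N) : (x * y).m = x.m + y.m := rfl

theorem mul_n (x y : FlatGroup ε N) : (x * y).n = x.n + (ε ^ x.m : ℤˣ) * y.n := rfl

theorem one_m : (1 : FlatGroup ε N).m = 0 := rfl

theorem one_n : (1 : FlatGroup ε N).n = 0 := rfl

instance : Group (FlatGroup ε N) :=
  Group.ofLeftAxioms
    (fun x y z => by
      ext
      · exact add_assoc _ _ _
      · simp only [mul_m, mul_n, zpow_add, Units.val_mul]
        ring)
    (fun x => by
      ext
      · exact zero_add _
      · simp only [one_m, one_n, mul_n, zpow_zero, Units.val_one]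
        ring)
    (fun x => by
      ext
      · exact neg_add_cancel _
      · change -((ε ^ (-x.m) : ℤˣ) * x.n) + (ε ^ (-x.m) : ℤˣ) * x.n = 0
        ring)

instance : MulAction (FlatGroup ε N) ℝ where
  smul x s := s + x.m
  one_smul s := by
    change s + ((0 : ℤ) : ℝ) = s
    simp
  mul_smul x y s := by
    change s + ((x.m + y.m : ℤ) : ℝ) = s + y.m + x.m
    push_cast
    ring

/-- The group law is respected because conjugation inverts rotations, just as `ε` reverses the
second translation. -/
noncomputable instance : MulAction (FlatGroup ε N) ℂ where
  smul x z := turn N x.n * signConj (ε ^ x.m) z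
  one_smul z := by
    change turn N ((0 : ℤ) : ℝ) * signConj (ε ^ (0 : ℤ)) z = z
    rw [Int.cast_zero, turn_zero, zpow_zero, signConj_one, one_mul]
  mul_smul x y z := by
    change turn N ((x.n + (ε ^ x.m : ℤˣ) * y.n : ℤ) : ℝ) * signConj (ε ^ (x.m + y.m)) z =
      turn N x.n * signConj (ε ^ x.m) (turn N y.n * signConj (ε ^ y.m) z)
    rw [signConj_mul, signConj_signConj, signConj_turn, ← zpow_add, ← mul_assoc, ← turn_add]
    push_cast
    rfl

/-- This takes precedence over the coordinatewise action. -/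
noncomputable instance : SMul (FlatGroup ε N) (Euc 2) where
  smul x a := !₂[a 0 + x.m, ((ε ^ x.m : ℤˣ) : ℤ) * a 1 + x.n]

noncomputable instance : MulAction (FlatGroup ε N) (Euc 2) where
  one_smul a := by
    change !₂[a 0 + ((0 : ℤ) : ℝ), ((ε ^ (0 : ℤ) : ℤˣ) : ℤ) * a 1 + ((0 : ℤ) : ℝ)] = a
    ext i
    fin_cases i <;> simp
  mul_smul x y a := by
    change !₂[a 0 + ((x.m + y.m : ℤ) : ℝ), ((ε ^ (x.m + y.m) : ℤˣ) : ℤ) * a 1 +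
      ((x.n + (ε ^ x.m : ℤˣ) * y.n : ℤ) : ℝ)] = !₂[a 0 + (y.m : ℝ) + x.m,
        ((ε ^ x.m : ℤˣ) : ℤ) * (((ε ^ y.m : ℤˣ) : ℤ) * a 1 + (y.n : ℝ)) + x.n]
    rw [zpow_add, Units.val_mul]
    ext i
    fin_cases i
    · simp
      ring
    · simp
      ring

theorem smul_real (x : FlatGroup ε N) (s : ℝ) : x • s = s + x.m := rfl

theorem smul_complex (x : FlatGroup ε N) (z : ℂ) :
    x • z = turn N x.n * signConj (ε ^ x.m) z := rfl

theorem smul_euc (x : FlatGroup ε N) (a : Euc 2) :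
    x • a = !₂[a 0 + x.m, ((ε ^ x.m : ℤˣ) : ℤ) * a 1 + x.n] := rfl

theorem norm_smul_complex (x : FlatGroup ε N) (z : ℂ) : ‖x • z‖ = ‖z‖ := by
  rw [smul_complex, norm_mul, norm_turn, one_mul, norm_signConj]

theorem dist_smul_complex (x : FlatGroup ε N) (z w : ℂ) : dist (x • z) (x • w) = dist z w := by
  rw [dist_eq_norm, dist_eq_norm, smul_complex, smul_complex, ← mul_sub, ← signConj_sub, norm_mul,
    norm_turn, one_mul, norm_signConj]

/-- The action on the solid cylinder is a tube action if the rotation number is right. -/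
theorem isTubeAction (hN : 0 < N) {ι : Type u} [MulAction (FlatGroup ε N) ι]
    (hι : ∀ (n : ℤ) (a : ι), (⟨0, n⟩ : FlatGroup ε N) • a = a → (N : ℤ) ∣ n) :
    IsTubeAction (FlatGroup ε N) ℂ ℝ ι where
  norm_smul := norm_smul_complex
  dist_smul x v w := by
    rw [Prod.dist_eq, Prod.dist_eq, Prod.smul_fst, Prod.smul_fst, Prod.smul_snd, Prod.smul_snd,
      dist_smul_complex, smul_real, smul_real, dist_add_right]
  contDiff_smul x := by
    refine ContDiff.prodMk (contDiff_const.mul ((contDiff_signConj _).comp contDiff_fst)) ?_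
    exact contDiff_snd.add contDiff_const
  smul_eq_or_one_le_dist x a hx := by
    obtain ⟨m, n⟩ := x
    rcases eq_or_ne m 0 with rfl | hm
    · left
      -- Without axial shift, the rotation is through `k` full turns.
      obtain ⟨k, rfl⟩ := hι n a hx
      rintro ⟨z, s⟩
      refine Prod.ext ?_ ?_
      · change turn N ((N * k : ℤ) : ℝ) * signConj (ε ^ (0 : ℤ)) z = z
        rw [zpow_zero, signConj_one, (turn_eq_turn_iff hN (t := 0)).2 ⟨k, by push_cast; ring⟩,
          turn_zero, one_mul]
      · change s + ((0 : ℤ) : ℝ) = s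
        simp
    · right
      rintro ⟨z, s⟩
      -- The axial shift by the nonzero integer `m` alone bounds the sup distance from below.
      refine le_trans ?_ (le_max_right _ _)
      change 1 ≤ dist s (s + (m : ℝ))
      rw [dist_self_add_right, Real.norm_eq_abs]
      exact_mod_cast Int.one_le_abs hm

/-- The map from the plane to the boundary of the solid cylinder. -/
noncomputable def cylinderMap (N : ℕ) (a : Euc 2) : ℂ × ℝ := (turn N (a 1), a 0)

theorem cylinderMap_smul (x : FlatGroup ε N) (a : Euc 2) :
    cylinderMap N (x • a) = x • cylinderMap N a := by
  refine Prod.ext ?_ rfl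
  change turn N (((ε ^ x.m : ℤˣ) : ℤ) * a 1 + x.n) = turn N x.n * signConj (ε ^ x.m) (turn N (a 1))
  rw [signConj_turn, ← turn_add, add_comm]

theorem isTubeBoundary_cylinderMap (hN : 0 < N) : IsTubeBoundary (cylinderMap N) where
  contMDiff := by
    refine ContDiff.contMDiff (ContDiff.prodMk ?_ ?_)
    · exact (contDiff_turn N).comp (EuclideanSpace.proj (𝕜 := ℝ) (1 : Fin 2)).contDiff
    · exact (EuclideanSpace.proj (𝕜 := ℝ) (0 : Fin 2)).contDiff
  norm_fst a := norm_turn _ _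
  exists_apply_eq v hv := by
    refine ⟨!₂[v.2, N / (2 * Real.pi) * Complex.arg v.1], Prod.ext ?_ (by simp [cylinderMap])⟩
    have h1 := Complex.norm_mul_exp_arg_mul_I v.1
    rw [hv, Complex.ofReal_one, one_mul] at h1
    have h2 : 2 * Real.pi / N * (N / (2 * Real.pi) * Complex.arg v.1) = Complex.arg v.1 := by
      have : (N : ℝ) ≠ 0 := Nat.cast_ne_zero.2 hN.ne'
      have := Real.pi_ne_zero
      field_simp
    simp [cylinderMap, turn, -Complex.ofReal_mul, -Complex.ofReal_div, h2, h1]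
  exists_section a₀ := by
    have hN' : (N : ℝ) ≠ 0 := Nat.cast_ne_zero.2 hN.ne'
    have hpi := Real.pi_ne_zero
    set z₀ := turn N (a₀ 1) with hz₀
    have hz₀0 : z₀ ≠ 0 := norm_ne_zero_iff.1 (by rw [norm_turn]; exact one_ne_zero)
    -- Dividing by `z₀` centres the principal branch of the logarithm at the base point, away from
    -- its cut; `N / (2π)` converts the angle back to the second coordinate.
    refine ⟨fun v => !₂[v.2, a₀ 1 + N / (2 * Real.pi) * (Complex.log (v.1 / z₀)).im], ?_, ?_⟩
    · have h1 : ∀ᶠ a : Euc 2 in 𝓝 a₀, |2 * Real.pi / N * (a 1 - a₀ 1)| < Real.pi := by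
        have hc : Continuous fun a : Euc 2 => |2 * Real.pi / N * (a 1 - a₀ 1)| := by fun_prop
        refine hc.continuousAt.eventually_lt continuousAt_const ?_
        simp [Real.pi_pos]
      filter_upwards [h1] with a ha
      have h2 : turn N (a 1) / z₀ =
          Complex.exp (((2 * Real.pi / N * (a 1 - a₀ 1) : ℝ) : ℂ) * Complex.I) := by
        rw [div_eq_iff hz₀0, hz₀, ← turn, ← turn_add, sub_add_cancel]
      have h3 : (Complex.log (turn N (a 1) / z₀)).im = 2 * Real.pi / N * (a 1 - a₀ 1) := by
        rw [h2, Complex.log_exp]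
        · simp
        · simpa using (abs_lt.1 ha).1
        · simpa using (abs_lt.1 ha).2.le
      ext i
      fin_cases i
      · simp [cylinderMap]
      · simp only [cylinderMap, h3]
        simp
        field_simp
        ring
    · have hc : ContinuousAt (fun v : ℂ × ℝ => v.1 / z₀) (cylinderMap N a₀) := by fun_prop
      have h1 : ∀ᶠ v : ℂ × ℝ in 𝓝 (cylinderMap N a₀), v.1 / z₀ ∈ Complex.slitPlane := by
        refine hc.eventually_mem (Complex.isOpen_slitPlane.mem_nhds ?_)
        change z₀ / z₀ ∈ _
        rw [div_self hz₀0]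
        exact Complex.one_mem_slitPlane
      filter_upwards [h1] with v hv
      constructor
      · refine ContDiffAt.contMDiffAt ?_
        have hlog : ContDiffAt ℝ ∞ (fun v : ℂ × ℝ => (Complex.log (v.1 / z₀)).im) v := by
          have h2 : ContDiffAt ℝ ∞ Complex.log (v.1 / z₀) :=
            (Complex.contDiffAt_log hv).restrict_scalars ℝ
          have h3 : ContDiffAt ℝ ∞ (fun v : ℂ × ℝ => v.1 / z₀) v := by
            simp only [div_eq_mul_inv]
            exact contDiffAt_fst.mul contDiffAt_const
          exact Complex.imCLM.contDiff.contDiffAt.comp v (h2.comp v h3)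
        rw [contDiffAt_euclidean]
        intro i
        fin_cases i
        · exact contDiffAt_snd
        · exact contDiffAt_const.add (contDiffAt_const.mul hlog)
      · intro hv1
        refine Prod.ext ?_ rfl
        change turn N (a₀ 1 + N / (2 * Real.pi) * (Complex.log (v.1 / z₀)).im) = v.1
        have hnorm : ‖v.1 / z₀‖ = 1 := by rw [norm_div, hv1, hz₀, norm_turn, div_one]
        have h2 : 2 * Real.pi / N * (N / (2 * Real.pi) * (Complex.log (v.1 / z₀)).im) =
            Complex.arg (v.1 / z₀) := by
          rw [Complex.log_im]
          field_simp
        have h3 := Complex.norm_mul_exp_arg_mul_I (v.1 / z₀)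
        rw [hnorm, Complex.ofReal_one, one_mul] at h3
        rw [turn_add, ← hz₀, turn, h2, h3, mul_div_cancel₀ _ hz₀0]

end FlatGroup

theorem exists_bundleLift_of_simplyConnected {G : Type v} [Group G] {S : Type} {Q : Type u}
    {M : Type w} [TopologicalSpace S] [SimplyConnectedSpace S] [LocallyPathConnectedSpace S]
    [TopologicalSpace Q] [ChartedSpace (Euc 2) Q] [TopologicalSpace M] [ChartedSpace (Euc 2) M]
    [MulAction G Q] {p : Q → M} (hp : IsPrincipalBundle G p) {f : S → M} (hf : Continuous f)
    {a : S} {q : Q} (h : p q = f a) : ∃ F : BundleLift p f, F a = q := by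
  obtain ⟨F, ⟨h1, h2⟩, -⟩ :=
    hp.isQuotientCoveringMap.isCoveringMap.existsUnique_continuousMap_lifts ⟨f, hf⟩ a q h
  exact ⟨⟨F, F.continuous, fun b => congrFun h2 b⟩, h1⟩

/-- An extension of the action is obtained from tubes whose boundary covers the base. -/
theorem isExtendable_of_isTubeBoundary {G : Type v} [Group G] [Finite G] {S : Type} {Q : Type u}
    {M : Type w} [TopologicalSpace S] [ChartedSpace (Euc 2) S] [PreconnectedSpace S] [Nonempty S]
    [TopologicalSpace Q] [ChartedSpace (Euc 2) Q] [IsManifold (𝓡 2) ∞ Q] [CompactSpace Q]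
    [TopologicalSpace M] [ChartedSpace (Euc 2) M] [MulAction G Q] {p : Q → M}
    [hp : Fact (IsPrincipalBundle G p)] {f : S → M} (hf : IsLocalDiffeomorph (𝓡 2) (𝓡 2) ∞ f)
    {Γ V B : Type} [Group Γ] [NormedAddCommGroup V] [InnerProductSpace ℝ V]
    [NormedAddCommGroup B] [NormedSpace ℝ B] [MulAction Γ V] [MulAction Γ B]
    [MulAction Γ S] [IsDeckAction Γ f] [IsTubeAction Γ V B (BundleLift p f)]
    (L : (V × B) ≃L[ℝ] Euc 3) {j : S → V × B} (hj : IsTubeBoundary j)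
    (hjΓ : ∀ (γ : Γ) (a : S), j (γ • a) = γ • j a)
    {K : Set (V × B)} (hK : IsCompact K) (hK1 : K ⊆ {v | ‖v.1‖ ≤ 1})
    (hK2 : ∀ v : V × B, ‖v.1‖ ≤ 1 → ∃ γ : Γ, γ • v ∈ K)
    (hlift : ∀ q : Q, ∃ (F : BundleLift p f) (a : S), F a = q)
    (hjF : ∀ (F : BundleLift p f) (a b : S), j a = j b → F a = F b) (F₀ : BundleLift p f) :
    ∃ H, letI := TubeQuotient.chartedSpace (S := range (BundleLift.boundaryMap Γ p f j F₀)) H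
      IsEquivariantFilling G (BundleLift.boundaryMap Γ p f j F₀) := by
  have := BundleLift.finite (S := S) (f := f) hp.out
  have hi := BundleLift.isBoundaryParametrisationAt_boundaryMap hj hjΓ F₀ hp.out hf hlift
  exact ⟨TubeQuotient.exists_adapted_chart L hi fun F v hv =>
      BundleLift.sheet_mem_range_boundaryMap hj hjΓ F₀ hp.out F hv,
    TubeQuotient.isEquivariantFilling hK hK1 hK2 hi
      (BundleLift.boundaryMap_injective hj hjΓ F₀ hp.out hlift hjF)
      (BundleLift.boundaryMap_smul hj hjΓ F₀ hlift) _⟩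

section Flat

variable {G : Type v} [Group G] [Finite G] {Q : Type u} {M : Type w}
    [TopologicalSpace Q] [ChartedSpace (Euc 2) Q]
    [TopologicalSpace M] [ChartedSpace (Euc 2) M] [MulAction G Q] {p : Q → M} {f : Euc 2 → M}

/-- Translating `F₀` by `(0, 1)` gives another lift, hence `y • F₀` for one `y ∈ G`, and `N` is the
order of `y`. Any other lift is `g • F₀` and has the same period, so one rotation number serves all
sheets. -/
theorem exists_period (hp : IsPrincipalBundle G p)
    (hf : ∀ s t : ℝ, f !₂[s, t + 1] = f !₂[s, t]) (F₀ : BundleLift p f) :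
    ∃ N : ℕ, 0 < N ∧ ∀ (F : BundleLift p f) (s t : ℝ) (n : ℤ),
      F !₂[s, t + n] = F !₂[s, t] ↔ (N : ℤ) ∣ n := by
  have : Fact (IsPrincipalBundle G p) := ⟨hp⟩
  have := hp.isQuotientCoveringMap.isCancelSMul
  have heta : ∀ a : Euc 2, !₂[a 0, a 1] = a := fun a => by
    ext i; fin_cases i <;> rfl
  let F₁ : BundleLift p f := ⟨fun a => F₀ !₂[a 0, a 1 + 1],
    F₀.continuous_toFun.comp (by fun_prop), fun a => by
      rw [F₀.apply_toFun, hf, heta]⟩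
  obtain ⟨y, hy⟩ := BundleLift.exists_smul_eq (G := G) F₀ F₁
  have h1 : ∀ s t : ℝ, F₀ !₂[s, t + 1] = y • F₀ !₂[s, t] := fun s t =>
    (congrArg (fun F : BundleLift p f => F !₂[s, t]) hy).symm
  have h2 : ∀ (n : ℤ) (s t : ℝ), F₀ !₂[s, t + n] = y ^ n • F₀ !₂[s, t] := by
    intro n
    induction n using Int.induction_on with
    | zero => intro s t; simp
    | succ k ih =>
      intro s t
      push_cast at ih ⊢
      rw [← add_assoc, h1, ih, ← mul_smul, zpow_add_one, zpow_natCast, ← pow_succ', pow_succ]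
    | pred k ih =>
      intro s t
      have h3 := h1 s (t + ((-(k : ℤ) - 1 : ℤ) : ℝ))
      rw [show t + ((-(k : ℤ) - 1 : ℤ) : ℝ) + 1 = t + ((-(k : ℤ) : ℤ) : ℝ) by push_cast; ring,
        ih] at h3
      rw [← inv_smul_eq_iff.2 h3, ← mul_smul, ← zpow_neg_one, ← zpow_add]
      congr 2
      ring
  refine ⟨orderOf y, orderOf_pos y, fun F s t n => ?_⟩
  obtain ⟨g, rfl⟩ := BundleLift.exists_smul_eq (G := G) F₀ F
  rw [BundleLift.smul_apply', BundleLift.smul_apply', h2, smul_left_cancel_iff,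
    orderOf_dvd_iff_zpow_eq_one]
  constructor
  · intro h
    exact IsCancelSMul.right_cancel (y ^ n) 1 (F₀ !₂[s, t]) (h.trans (one_smul G _).symm)
  · intro h
    rw [h, one_smul]

/-- Bundles over the quotient of the plane by the group of all
`(s, t) ↦ (s + m, ε ^ m t + n)` are extendable. -/
theorem isExtendable_of_flat [IsManifold (𝓡 2) ∞ Q] [CompactSpace Q]
    (hp : IsPrincipalBundle G p) (ε : ℤˣ)
    (hf : IsSmoothQuotient f fun a b =>
      ∃ m n : ℤ, b 0 = a 0 + m ∧ b 1 = ((ε ^ m : ℤˣ) : ℤ) * a 1 + n) : IsExtendable G Q := by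
  have : Fact (IsPrincipalBundle G p) := ⟨hp⟩
  have hfc : Continuous f := hf.isLocalDiffeomorph.contMDiff.continuous
  have heta : ∀ a : Euc 2, !₂[a 0, a 1] = a := fun a => by
    ext i; fin_cases i <;> rfl
  have hlift : ∀ q : Q, ∃ (F : BundleLift p f) (a : Euc 2), F a = q := by
    intro q
    obtain ⟨a, ha⟩ := hf.surjective (p q)
    obtain ⟨F, hF⟩ := exists_bundleLift_of_simplyConnected hp hfc ha.symm
    exact ⟨F, a, hF⟩
  obtain ⟨q₀, hq₀⟩ := hp.isQuotientCoveringMap.surjective (f 0)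
  obtain ⟨F₀, -⟩ := exists_bundleLift_of_simplyConnected hp hfc hq₀
  obtain ⟨N, hN, hper⟩ := exists_period hp
    (fun s t => ((hf.apply_eq_iff _ _).2 ⟨0, 1, by simp, by simp⟩).symm) F₀
  have hdeck : IsDeckAction (FlatGroup ε N) f :=
    { continuous_smul := fun γ => by
        simp only [FlatGroup.smul_euc]
        fun_prop
      apply_smul := fun γ a =>
        ((hf.apply_eq_iff _ _).2 ⟨γ.m, γ.n, rfl, rfl⟩).symm
      exists_smul_eq := fun a b h => by
        obtain ⟨m, n, h0, h1⟩ := (hf.apply_eq_iff _ _).1 h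
        refine ⟨⟨m, n⟩, ?_⟩
        rw [FlatGroup.smul_euc, ← h0, ← h1, heta] }
  have htube : IsTubeAction (FlatGroup ε N) ℂ ℝ (BundleLift p f) := by
    refine FlatGroup.isTubeAction hN fun n F h => ?_
    rw [← hper F 0 0 n]
    -- If this element fixes `F`, then `F` agrees at `(0, 0)` and `(0, n)`, so `n` is a period.
    have h1 := BundleLift.smul_apply_smul (⟨0, n⟩ : FlatGroup ε N) F !₂[0, 0]
    rw [h, FlatGroup.smul_euc] at h1
    simpa using h1
  obtain ⟨H, hH⟩ := isExtendable_of_isTubeBoundary (G := G) (Γ := FlatGroup ε N) (V := ℂ)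
    (B := ℝ) (j := FlatGroup.cylinderMap N) hf.isLocalDiffeomorph
    (ContinuousLinearEquiv.ofFinrankEq (by simp))
    (FlatGroup.isTubeBoundary_cylinderMap hN) FlatGroup.cylinderMap_smul
    -- Axial shifts by integers bring every point of the cylinder into this compact piece.
    (K := Metric.closedBall 0 1 ×ˢ Icc 0 1) ((isCompact_closedBall _ _).prod isCompact_Icc)
    (fun v hv => mem_closedBall_zero_iff.1 hv.1)
    (fun v hv => ⟨⟨-⌊v.2⌋, 0⟩, mem_closedBall_zero_iff.2
      ((FlatGroup.norm_smul_complex _ v.1).trans_le hv), by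
        change v.2 + ((-⌊v.2⌋ : ℤ) : ℝ) ∈ Icc (0 : ℝ) 1
        have h1 := Int.floor_le v.2
        have h2 := Int.lt_floor_add_one v.2
        push_cast
        constructor <;> linarith⟩) hlift (fun F a b hab => by
      obtain ⟨h1, h2⟩ := Prod.ext_iff.1 hab
      -- Points with the same image on the cylinder differ by a multiple of the period `N` in the
      -- second coordinate.
      obtain ⟨k, hk⟩ := (turn_eq_turn_iff hN).1 h1
      have h3 := (hper F (b 0) (b 1) (k * N)).2 (Dvd.intro_left k rfl)
      rw [← heta a, ← heta b, show a 0 = b 0 from h2, hk, ← h3]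
      push_cast
      rfl) F₀
  exact ⟨_, _, _, _, _, hH⟩

end Flat

/-! ### Lifts of maps on the sphere -/

/-- Stereographic projection from `v` turns the punctured sphere into a vector space, which is
simply connected. -/
theorem IsCoveringMap.exists_lift_compl_singleton {Q : Type u} {M : Type w} [TopologicalSpace Q]
    [TopologicalSpace M] {p : Q → M} (hp : IsCoveringMap p) {f : TwoSphere → M}
    (hf : Continuous f) (v : TwoSphere) {a : TwoSphere} (ha : a ≠ v) {q : Q} (hq : p q = f a) :
    ∃ F : TwoSphere → Q, ContinuousOn F {v}ᶜ ∧ (∀ b ≠ v, p (F b) = f b) ∧ F a = q := by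
  set φ := stereographic (norm_eq_of_mem_sphere v) with hφ
  have hsrc : φ.source = {v}ᶜ := stereographic_source _
  have htgt : φ.target = univ := stereographic_target _
  have hsymm : Continuous φ.symm := by
    rw [← continuousOn_univ, ← htgt]
    exact φ.continuousOn_symm
  have hinv : ∀ b ≠ v, φ.symm (φ b) = b := fun b hb => φ.left_inv (by rw [hsrc]; exact hb)
  obtain ⟨F, ⟨h1, h2⟩, -⟩ := hp.existsUnique_continuousMap_lifts
    ⟨fun x => f (φ.symm x), hf.comp hsymm⟩ (φ a) q (by simpa [hinv a ha] using hq)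
  refine ⟨fun b => F (φ b), ?_, fun b hb => ?_, h1⟩
  · rw [← hsrc]
    exact F.continuous.comp_continuousOn φ.continuousOn
  · have h3 := congrFun h2 (φ b)
    simpa [hinv b hb] using h3

/-- Stereographic projection from `-v` sends `v` to the origin, and a plane minus a point is
connected. -/
theorem isConnected_compl_antipodal (v : TwoSphere) : IsConnected ({-v}ᶜ ∩ {v}ᶜ : Set TwoSphere) := by
  set φ := stereographic (norm_eq_of_mem_sphere (-v)) with hφ
  have hsrc : φ.source = {-v}ᶜ := stereographic_source _
  have htgt : φ.target = univ := stereographic_target _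
  have h0 : φ v = 0 := stereographic_neg_apply v
  have hsymm : Continuous φ.symm := by
    rw [← continuousOn_univ, ← htgt]
    exact φ.continuousOn_symm
  have hrank : 1 < Module.rank ℝ (Submodule.span ℝ {((-v : TwoSphere) : Euc 3)})ᗮ := by
    have : Fact (Module.finrank ℝ (Euc 3) = 2 + 1) := ⟨by simp⟩
    have h1 : Module.finrank ℝ (Submodule.span ℝ {((-v : TwoSphere) : Euc 3)})ᗮ = 2 :=
      Submodule.finrank_orthogonal_span_singleton (ne_zero_of_mem_unit_sphere (-v))
    rw [← Module.finrank_eq_rank, h1]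
    norm_num
  convert (isConnected_compl_singleton_of_one_lt_rank hrank 0).image φ.symm hsymm.continuousOn using 1
  ext b
  constructor
  · rintro ⟨hb, hb'⟩
    refine ⟨φ b, fun h => hb' ?_, φ.left_inv (hsrc ▸ hb)⟩
    have hv : v ∈ φ.source := by
      rw [hsrc]
      exact fun h => ne_neg_of_mem_unit_sphere ℝ v h
    exact φ.injOn (hsrc ▸ hb) hv (by rw [h0]; exact h)
  · rintro ⟨x, hx, rfl⟩
    have hx' : φ.symm x ∈ φ.source := φ.map_target (by rw [htgt]; trivial)
    refine ⟨hsrc ▸ hx', fun h => hx ?_⟩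
    have h1 := φ.right_inv (x := x) (by rw [htgt]; trivial)
    rw [mem_singleton_iff.1 h, h0] at h1
    exact h1.symm

/-- Lifts over the complements of `-a` and of `a` that agree at one common point agree on the
connected overlap, so they glue. -/
theorem IsCoveringMap.exists_lift_sphere {Q : Type u} {M : Type w} [TopologicalSpace Q]
    [TopologicalSpace M] {p : Q → M} (hp : IsCoveringMap p) {f : TwoSphere → M}
    (hf : Continuous f) {a : TwoSphere} {q : Q} (hq : p q = f a) :
    ∃ F : TwoSphere → Q, Continuous F ∧ (∀ b, p (F b) = f b) ∧ F a = q := by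
  classical
  have ha : a ≠ -a := ne_neg_of_mem_unit_sphere ℝ a
  obtain ⟨F₁, h1c, h1p, h1a⟩ := hp.exists_lift_compl_singleton hf (-a) ha hq
  have hconn := isConnected_compl_antipodal a
  obtain ⟨b, hb, hb'⟩ := hconn.nonempty
  obtain ⟨F₂, h2c, h2p, h2b⟩ := hp.exists_lift_compl_singleton hf a hb' (h1p b hb)
  have heq : EqOn F₁ F₂ ({-a}ᶜ ∩ {a}ᶜ) :=
    hp.eqOn_of_comp_eqOn hconn.isPreconnected (h1c.mono inter_subset_left)
      (h2c.mono inter_subset_right) (fun c hc => (h1p c hc.1).trans (h2p c hc.2).symm)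
      ⟨hb, hb'⟩ h2b.symm
  have hF₁ : EqOn (fun c => if c = -a then F₂ c else F₁ c) F₁ {-a}ᶜ := fun c hc => if_neg hc
  have hF₂ : EqOn (fun c => if c = -a then F₂ c else F₁ c) F₂ {a}ᶜ := fun c hc => by
    by_cases h : c = -a
    · exact if_pos h
    · exact (if_neg h).trans (heq ⟨h, hc⟩)
  refine ⟨fun c => if c = -a then F₂ c else F₁ c, continuous_iff_continuousAt.2 fun c => ?_,
    fun c => ?_, (hF₁ ha).trans h1a⟩
  · by_cases h : c = -a
    · have hc : c ∈ ({a}ᶜ : Set TwoSphere) := fun h' => ha (h'.symm.trans h)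
      exact (h2c.congr hF₂).continuousAt (isOpen_compl_singleton.mem_nhds hc)
    · exact (h1c.congr hF₁).continuousAt (isOpen_compl_singleton.mem_nhds h)
  · by_cases h : c = -a
    · have hc : c ≠ a := fun h' => ha (h'.symm.trans h)
      exact (congrArg p (hF₂ hc)).trans (h2p c hc)
    · exact (congrArg p (hF₁ h)).trans (h1p c h)

/-! ### Bundles over the projective plane -/

namespace TwoSphere

noncomputable instance : MulAction ℤˣ TwoSphere where
  smul u a := if u = 1 then a else -a
  one_smul a := if_pos rfl
  mul_smul u u' a := by
    change (if u * u' = 1 then a else -a) = if u = 1 then if u' = 1 then a else -a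
      else -(if u' = 1 then a else -a)
    have h : ¬ ((-1 : ℤˣ) = 1) := by decide
    rcases Int.units_eq_one_or u with rfl | rfl <;> rcases Int.units_eq_one_or u' with rfl | rfl <;>
      simp [h]

theorem neg_one_smul (a : TwoSphere) : (-1 : ℤˣ) • a = -a :=
  if_neg (by decide)

/-- The inclusion of the sphere as the boundary of the ball. -/
noncomputable def inclusion (a : TwoSphere) : Euc 3 × Euc 0 := (a, 0)

theorem inclusion_smul (u : ℤˣ) (a : TwoSphere) : inclusion (u • a) = u • inclusion a := by
  rcases Int.units_eq_one_or u with rfl | rfl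
  · rw [one_smul, one_smul]
  · rw [neg_one_smul]
    refine Prod.ext ?_ (Subsingleton.elim _ _)
    change -(a : Euc 3) = (-1 : ℤˣ) • (a : Euc 3)
    rw [Units.neg_smul, one_smul]

theorem inclusion_injective : Function.Injective inclusion := fun _ _ h =>
  Subtype.ext (congrArg Prod.fst h)

open Classical in
/-- The radial projection to the sphere, with a junk value on the axis. -/
noncomputable def normalize (a₀ : TwoSphere) (v : Euc 3 × Euc 0) : TwoSphere :=
  if h : 0 < ‖v.1‖ then ⟨(TubeQuotient.radial v).1, by
    rw [mem_sphere_zero_iff_norm, TubeQuotient.norm_radial_fst h]⟩ else a₀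

theorem contMDiffAt_normalize (a₀ : TwoSphere) {v : Euc 3 × Euc 0} (hv : 0 < ‖v.1‖) :
    ContMDiffAt 𝓘(ℝ, Euc 3 × Euc 0) (𝓡 2) ∞ (normalize a₀) v := by
  have : Fact (Module.finrank ℝ (Euc 3) = 2 + 1) := ⟨by simp⟩
  -- `ContMDiff.codRestrict_sphere` applies to globally smooth maps into the sphere, hence the
  -- passage to the open set where the norm is positive.
  let O : TopologicalSpace.Opens (Euc 3 × Euc 0) :=
    ⟨{v | 0 < ‖v.1‖}, isOpen_lt continuous_const (by fun_prop)⟩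
  have h1 : ContMDiff 𝓘(ℝ, Euc 3 × Euc 0) 𝓘(ℝ, Euc 3) ∞
      (fun w : O => (TubeQuotient.radial w.1).1) := by
    intro w
    rw [contMDiffAt_subtype_iff (U := O) (f := fun w : Euc 3 × Euc 0 => (TubeQuotient.radial w).1)]
    exact ((TubeQuotient.contDiffOn_radial.fst).contDiffAt (O.2.mem_nhds w.2)).contMDiffAt
  have h2 := h1.codRestrict_sphere (n := 2) fun w => by
    rw [mem_sphere_zero_iff_norm, TubeQuotient.norm_radial_fst w.2]
  have h3 := h2 (⟨v, hv⟩ : O)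
  refine (contMDiffAt_subtype_iff (U := O) (x := ⟨v, hv⟩)).1 (h3.congr_of_eventuallyEq
    (Eventually.of_forall fun w => ?_))
  exact dif_pos w.2

theorem isTubeBoundary_inclusion : IsTubeBoundary inclusion where
  contMDiff := by
    have : Fact (Module.finrank ℝ (Euc 3) = 2 + 1) := ⟨by simp⟩
    have h : ContMDiff (𝓡 2) 𝓘(ℝ, Euc 3) ∞ ((↑) : TwoSphere → Euc 3) := contMDiff_coe_sphere
    exact h.prodMk_space contMDiff_const
  norm_fst a := norm_eq_of_mem_sphere a
  exists_apply_eq v hv := ⟨⟨v.1, mem_sphere_zero_iff_norm.2 hv⟩,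
    Prod.ext rfl (Subsingleton.elim _ _)⟩
  exists_section a₀ := by
    refine ⟨normalize a₀, Eventually.of_forall fun a => ?_, ?_⟩
    · have ha : ‖(inclusion a).1‖ = 1 := norm_eq_of_mem_sphere a
      rw [normalize, dif_pos (by rw [ha]; exact one_pos)]
      exact Subtype.ext (congrArg Prod.fst (TubeQuotient.radial_eq_self ha))
    · have h1 : ∀ᶠ v : Euc 3 × Euc 0 in 𝓝 (inclusion a₀), 0 < ‖v.1‖ := by
        refine (isOpen_lt continuous_const (by fun_prop)).mem_nhds ?_
        change 0 < ‖(a₀ : Euc 3)‖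
        rw [norm_eq_of_mem_sphere a₀]
        exact one_pos
      filter_upwards [h1] with v hv
      refine ⟨contMDiffAt_normalize a₀ hv, fun h => Prod.ext ?_ (Subsingleton.elim _ _)⟩
      rw [normalize, dif_pos hv]
      change (TubeQuotient.radial v).1 = v.1
      rw [TubeQuotient.radial_eq_self h]

/-- The antipodal action on the ball is a tube action if it is free on the indices. -/
theorem isTubeAction {ι : Type u} [MulAction ℤˣ ι] (hι : ∀ a : ι, (-1 : ℤˣ) • a ≠ a) :
    IsTubeAction ℤˣ (Euc 3) (Euc 0) ι where
  norm_smul u z := by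
    rcases Int.units_eq_one_or u with rfl | rfl
    · rw [one_smul]
    · rw [Units.neg_smul, one_smul, norm_neg]
  dist_smul u v w := by
    rcases Int.units_eq_one_or u with rfl | rfl
    · rw [one_smul, one_smul]
    · rw [Units.neg_smul, one_smul, Units.neg_smul, one_smul, dist_neg_neg]
  contDiff_smul u := by
    rcases Int.units_eq_one_or u with rfl | rfl
    · simp only [one_smul]
      exact contDiff_id
    · simp only [Units.neg_smul, one_smul]
      exact contDiff_neg
  smul_eq_or_one_le_dist u a h := by
    rcases Int.units_eq_one_or u with rfl | rfl
    · exact Or.inl (one_smul _)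
    -- The antipodal map fixes the centre of the ball, so neither alternative would hold; freeness
    -- on the indices excludes the case.
    · exact absurd h (hι a)

end TwoSphere

theorem halfEquator_one : halfEquator 1 = -halfEquator 0 := by
  refine Subtype.ext ?_
  change (!₂[Real.cos (Real.pi * ((1 : unitInterval) : ℝ)),
    Real.sin (Real.pi * ((1 : unitInterval) : ℝ)), 0] : Euc 3) =
    -!₂[Real.cos (Real.pi * ((0 : unitInterval) : ℝ)),
      Real.sin (Real.pi * ((0 : unitInterval) : ℝ)), 0]
  ext i
  fin_cases i <;> simp

theorem continuous_halfEquator : Continuous halfEquator := by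
  refine Continuous.subtype_mk ?_ _
  fun_prop

section ProjectivePlane

variable {G : Type v} [Group G] {Q : Type u} {M : Type w}
    [TopologicalSpace Q] [ChartedSpace (Euc 2) Q]
    [TopologicalSpace M] [ChartedSpace (Euc 2) M] [MulAction G Q] {p : Q → M} {f : TwoSphere → M}

theorem IsProjectivePlane.isDeckAction (hf : IsProjectivePlane f) : IsDeckAction ℤˣ f where
  continuous_smul u := by
    rcases Int.units_eq_one_or u with rfl | rfl
    · simp only [one_smul]
      exact continuous_id
    · simp only [TwoSphere.neg_one_smul]
      exact continuous_neg
  apply_smul u a := by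
    rcases Int.units_eq_one_or u with rfl | rfl
    · rw [one_smul]
    · rw [TwoSphere.neg_one_smul]
      exact ((hf.apply_eq_iff a (-a)).2 (Or.inr rfl)).symm
  exists_smul_eq a b h := by
    rcases (hf.apply_eq_iff a b).1 h with rfl | rfl
    · exact ⟨1, one_smul _ _⟩
    · exact ⟨-1, TwoSphere.neg_one_smul a⟩

theorem IsProjectivePlane.exists_bundleLift (hp : IsPrincipalBundle G p)
    (hf : IsProjectivePlane f) {a : TwoSphere} {q : Q} (h : p q = f a) :
    ∃ F : BundleLift p f, F a = q := by
  obtain ⟨F, h1, h2, h3⟩ := hp.isQuotientCoveringMap.isCoveringMap.exists_lift_sphere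
    hf.isLocalDiffeomorph.contMDiff.continuous h
  exact ⟨⟨F, h1, h2⟩, h3⟩

instance : PreconnectedSpace TwoSphere :=
  isPreconnected_iff_preconnectedSpace.1
    (isPreconnected_sphere (by rw [← Module.finrank_eq_rank]; simp) _ _)

instance : Nonempty TwoSphere := ⟨halfEquator 0⟩

/-- The monodromy along the middle circle describes the antipodal map on lifts. -/
theorem exists_neg_one_smul_eq [hp : Fact (IsPrincipalBundle G p)] (hf : IsProjectivePlane f)
    [IsDeckAction ℤˣ f] {x : G} (hx : HasMonodromy p (middleCircle f) x) :
    ∃ F : BundleLift p f, (-1 : ℤˣ) • F = x • F := by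
  obtain ⟨γ, h1, h2⟩ := hx
  obtain ⟨F, hF⟩ := hf.exists_bundleLift hp.out (h1 0)
  -- Both are lifts of the middle circle with the same initial point. Comparing their ends, at
  -- antipodal points of the equator, turns the monodromy into the action of `-1`.
  have h3 : (fun t => F (halfEquator t)) = γ :=
    hp.out.isQuotientCoveringMap.isCoveringMap.eq_of_comp_eq
      (F.continuous_toFun.comp continuous_halfEquator) γ.continuous
      (funext fun t => (F.apply_toFun _).trans (h1 t).symm) 0 hF
  refine ⟨F, BundleLift.eq_of_apply_eq hp.out (a := halfEquator 0) ?_⟩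
  rw [BundleLift.smul_apply, BundleLift.smul_apply', inv_neg, inv_one, TwoSphere.neg_one_smul,
    ← halfEquator_one, congrFun h3 1, hF, h2]

/-- Representatives of the lifts up to the antipodal map. -/
theorem exists_representatives [Finite G] [hp : Fact (IsPrincipalBundle G p)]
    [IsDeckAction ℤˣ f] {x : G} (hx2 : x ^ 2 = 1) (hx1 : x ≠ 1) {F₀ : BundleLift p f}
    (hF₀ : (-1 : ℤˣ) • F₀ = x • F₀) :
    ∃ R : Fin (Nat.card G / 2) → BundleLift p f,
      (∀ F, ∃ k, ∃ u : ℤˣ, u • R k = F) ∧ ∀ k l (u : ℤˣ), u • R k = R l → k = l := by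
  -- Since `-1` sends `g • F₀` to `(g * x) • F₀`, its orbits on lifts correspond to the left cosets
  -- of the subgroup `{1, x}`.
  have hcard : Nat.card (G ⧸ Subgroup.zpowers x) = Nat.card G / 2 := by
    have h := (Subgroup.zpowers x).card_mul_index
    rw [Nat.card_zpowers, orderOf_eq_prime hx2 hx1] at h
    rw [← h, Nat.mul_div_cancel_left _ two_pos]
    rfl
  let e := (Finite.equivFinOfCardEq hcard).symm
  refine ⟨fun k => (e k).out • F₀, fun F => ?_, fun k l u h => ?_⟩
  · obtain ⟨g, rfl⟩ := BundleLift.exists_smul_eq (G := G) F₀ F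
    obtain ⟨k, hk⟩ := e.surjective (g : G ⧸ Subgroup.zpowers x)
    obtain ⟨h, hh⟩ := QuotientGroup.mk_out_eq_mul (Subgroup.zpowers x) g
    refine ⟨k, ?_⟩
    simp only [hk]
    rw [hh]
    obtain ⟨i, hi⟩ := Subgroup.mem_zpowers_iff.1 h.2
    rcases Int.even_or_odd' i with ⟨c, rfl | rfl⟩
    · refine ⟨1, ?_⟩
      rw [← hi, zpow_mul, zpow_ofNat, hx2, one_zpow, mul_one, one_smul]
    · refine ⟨-1, ?_⟩
      rw [← hi, zpow_add, zpow_mul, zpow_ofNat, hx2, one_zpow, one_mul, zpow_one,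
        ← smul_comm (g * x) (-1 : ℤˣ) F₀, hF₀, ← mul_smul, mul_assoc, ← pow_two, hx2, mul_one]
  · refine e.injective ?_
    simp only at h
    rw [← QuotientGroup.out_eq' (e k), ← QuotientGroup.out_eq' (e l), QuotientGroup.eq,
      Subgroup.mem_zpowers_iff]
    rcases Int.units_eq_one_or u with rfl | rfl
    · rw [one_smul] at h
      refine ⟨0, ?_⟩
      rw [BundleLift.smul_left_injective F₀ h, zpow_zero, inv_mul_cancel]
    · rw [← smul_comm, hF₀, ← mul_smul] at h
      refine ⟨1, ?_⟩
      rw [← BundleLift.smul_left_injective F₀ h, inv_mul_cancel_left, zpow_one]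

/-- If `g • F₀` were fixed, then `(g * x) • F₀ = g • F₀`, and freeness of `G` on lifts would give `x
= 1`. -/
theorem neg_one_smul_ne [hp : Fact (IsPrincipalBundle G p)] [IsDeckAction ℤˣ f] {x : G}
    (hx1 : x ≠ 1) {F₀ : BundleLift p f} (hF₀ : (-1 : ℤˣ) • F₀ = x • F₀) (F : BundleLift p f) :
    (-1 : ℤˣ) • F ≠ F := by
  obtain ⟨g, rfl⟩ := BundleLift.exists_smul_eq (G := G) F₀ F
  intro h
  rw [← smul_comm, hF₀, ← mul_smul] at h
  exact hx1 (mul_eq_left.1 (BundleLift.smul_left_injective F₀ h))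

/-! ### The total space as a union of spheres and the filling as a union of balls. -/

theorem isUnionOfSpheres_of_representatives [T2Space Q] (hp : IsPrincipalBundle G p)
    (hf : IsProjectivePlane f) [IsDeckAction ℤˣ f]
    (hfree : ∀ F : BundleLift p f, (-1 : ℤˣ) • F ≠ F) {n : ℕ} {R : Fin n → BundleLift p f}
    (hR : ∀ F, ∃ k, ∃ u : ℤˣ, u • R k = F) (hR' : ∀ k l (u : ℤˣ), u • R k = R l → k = l) :
    IsUnionOfSpheres n Q := by
  have hbij : Function.Bijective fun x : Fin n × TwoSphere => R x.1 x.2 := by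
    constructor
    · rintro ⟨k, a⟩ ⟨l, b⟩ h
      simp only at h
      have h1 : f a = f b := by rw [← (R k).apply_toFun, ← (R l).apply_toFun, h]
      -- Coinciding values come from a sign relating the two lifts; representatives are
      -- inequivalent, and `-1` fixes no lift, so the sign is `1`.
      obtain ⟨u, rfl⟩ := IsDeckAction.exists_smul_eq (Γ := ℤˣ) a b h1
      have h2 : u • R k = R l := by
        refine BundleLift.eq_of_apply_eq hp (a := u • a) ?_
        rw [BundleLift.smul_apply_smul, h]
      obtain rfl := hR' k l u h2
      rcases Int.units_eq_one_or u with rfl | rfl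
      · rw [one_smul]
      · exact absurd h2 (hfree _)
    · intro q
      obtain ⟨a, ha⟩ := hf.surjective (p q)
      obtain ⟨F, hF⟩ := hf.exists_bundleLift hp ha.symm
      obtain ⟨k, u, rfl⟩ := hR F
      exact ⟨(k, u⁻¹ • a), hF⟩
  have hcont : Continuous fun x : Fin n × TwoSphere => R x.1 x.2 :=
    continuous_prod_of_discrete_left.2 fun k => (R k).continuous_toFun
  let e : Fin n × TwoSphere ≃ₜ Q :=
    Continuous.homeoOfEquivCompactToT2 (f := Equiv.ofBijective _ hbij) hcont
  refine ⟨e.symm, fun q => ?_, fun k => (R k).contMDiff hp hf.isLocalDiffeomorph⟩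
  obtain ⟨⟨k, a⟩, rfl⟩ := e.surjective q
  obtain ⟨l, -, hl, -⟩ := (R k).exists_local_inverse hp hf.isLocalDiffeomorph a
  refine (hl.self_of_nhds.1).congr_of_eventuallyEq ?_
  filter_upwards [hl] with q hq
  have h : e (k, l q) = q := hq.2
  exact congrArg Prod.snd (e.symm_apply_eq.2 h.symm)

theorem TubeQuotient.sheet_fst_zero {ι : Type u} [MulAction ℤˣ ι]
    [IsTubeAction ℤˣ (Euc 3) (Euc 0) ι] (a : ι) (v : Euc 3 × Euc 0) :
    TubeQuotient.sheet ℤˣ a (v.1, (0 : Euc 0)) = TubeQuotient.sheet ℤˣ a v := by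
  have h : (v.1, (0 : Euc 0)) = v := Prod.ext rfl (Subsingleton.elim _ _)
  rw [h]

/-- The sign action permutes the balls freely, so one ball from each orbit maps to the quotient
without identifications. In the sheet of `u • R k` the inverse is the smooth map `v ↦ u⁻¹ • v`. -/
theorem isUnionOfBalls_of_representatives {ι : Type u} [MulAction ℤˣ ι]
    [IsTubeAction ℤˣ (Euc 3) (Euc 0) ι] (hfree : ∀ a : ι, (-1 : ℤˣ) • a ≠ a) {n : ℕ}
    {R : Fin n → ι} (hR : ∀ a, ∃ k, ∃ u : ℤˣ, u • R k = a)
    (hR' : ∀ k l (u : ℤˣ), u • R k = R l → k = l)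
    {S : Set (TubeQuotient ℤˣ (Euc 3) (Euc 0) ι)}
    (H : ∀ y, ∃ h : OpenPartialHomeomorph (TubeQuotient ℤˣ (Euc 3) (Euc 0) ι)
      (EuclideanHalfSpace 3), TubeQuotient.IsSmoothChart h ∧ y ∈ h.source ∧
        (y ∈ S ↔ 0 = (h y).1 0)) :
    letI := TubeQuotient.chartedSpace H
    IsUnionOfBalls n (TubeQuotient ℤˣ (Euc 3) (Euc 0) ι) := by
  let _ := TubeQuotient.chartedSpace H
  have hB : ∀ a : ThreeBall, ‖(a : Euc 3)‖ ≤ 1 := fun a => mem_closedBall_zero_iff.1 a.2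
  let Ψ : Fin n × ThreeBall → TubeQuotient ℤˣ (Euc 3) (Euc 0) ι := fun x =>
    TubeQuotient.sheet ℤˣ (R x.1) ((x.2 : Euc 3), (0 : Euc 0))
  have hbij : Function.Bijective Ψ := by
    constructor
    · rintro ⟨k, a⟩ ⟨l, b⟩ h
      obtain ⟨u, h1, h2⟩ := (TubeQuotient.sheet_eq_sheet_iff (hB a) (hB b)).1 h
      obtain rfl := hR' k l u h2
      rcases Int.units_eq_one_or u with rfl | rfl
      · rw [one_smul] at h1
        exact Prod.ext rfl (Subtype.ext (congrArg Prod.fst h1))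
      · exact absurd h2 (hfree _)
    · intro y
      obtain ⟨a, v, hv, rfl⟩ := TubeQuotient.exists_sheet_eq y
      obtain ⟨k, u, rfl⟩ := hR a
      have hv' : ‖(u⁻¹ • v).1‖ ≤ 1 := (TubeQuotient.norm_smul_fst ι u⁻¹ v).trans_le hv
      refine ⟨(k, ⟨(u⁻¹ • v).1, mem_closedBall_zero_iff.2 hv'⟩), ?_⟩
      have h1 := TubeQuotient.sheet_smul u (R k) hv'
      rw [smul_inv_smul] at h1
      exact (TubeQuotient.sheet_fst_zero (R k) (u⁻¹ • v)).trans h1.symm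
  have hcont : Continuous Ψ := continuous_prod_of_discrete_left.2 fun k =>
    (TubeQuotient.continuousOn_sheet (R k)).comp_continuous (by fun_prop) fun a => hB a
  let e : Fin n × ThreeBall ≃ₜ TubeQuotient ℤˣ (Euc 3) (Euc 0) ι :=
    Continuous.homeoOfEquivCompactToT2 (f := Equiv.ofBijective _ hbij) hcont
  refine ⟨e.symm, fun k v => TubeQuotient.sheet ℤˣ (R k) (v, (0 : Euc 0)),
    TubeQuotient.contMDiff_of_comp_sheet H fun a => ?_, fun k => ⟨?_, fun a => rfl⟩⟩
  · obtain ⟨k, u, rfl⟩ := hR a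
    have h1 : ContDiff ℝ ∞ fun v : Euc 3 × Euc 0 => (u⁻¹ • v).1 :=
      contDiff_fst.comp (IsTubeAction.contDiff_smul (ι := ι) u⁻¹)
    refine h1.contMDiff.contMDiffOn.congr fun v hv => ?_
    have hv' : ‖(u⁻¹ • v).1‖ ≤ 1 := (TubeQuotient.norm_smul_fst ι u⁻¹ v).trans_le hv
    have h2 : e (k, ⟨(u⁻¹ • v).1, mem_closedBall_zero_iff.2 hv'⟩) =
        TubeQuotient.sheet ℤˣ (u • R k) v := by
      have h1 := TubeQuotient.sheet_smul u (R k) hv'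
      rw [smul_inv_smul] at h1
      exact (TubeQuotient.sheet_fst_zero (R k) (u⁻¹ • v)).trans h1.symm
    rw [← h2, e.symm_apply_apply]
  · refine (TubeQuotient.contMDiffOn_sheet H (R k)).comp (t := {v : Euc 3 × Euc 0 | ‖v.1‖ ≤ 1})
      (f := fun v : Euc 3 => (v, (0 : Euc 0))) ?_ ?_
    · exact (contDiff_id.prodMk contDiff_const).contMDiff.contMDiffOn
    · exact fun v hv => mem_closedBall_zero_iff.1 hv

theorem isExtendableToBalls_of_isProjectivePlane [Finite G] [IsManifold (𝓡 2) ∞ Q] [T2Space Q]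
    [CompactSpace Q] (hp : IsPrincipalBundle G p) (hf : IsProjectivePlane f) {x : G}
    (hx : HasMonodromy p (middleCircle f) x) (hx2 : x ^ 2 = 1) (hx1 : x ≠ 1) :
    IsUnionOfSpheres (Nat.card G / 2) Q ∧ IsExtendableToBalls (Nat.card G / 2) G Q := by
  have : Fact (IsPrincipalBundle G p) := ⟨hp⟩
  have := hf.isDeckAction
  obtain ⟨F₀, hF₀⟩ := exists_neg_one_smul_eq hf hx
  have hfree := neg_one_smul_ne hx1 hF₀
  obtain ⟨R, hR, hR'⟩ := exists_representatives hx2 hx1 hF₀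
  have := TwoSphere.isTubeAction hfree
  obtain ⟨H, hH⟩ := isExtendable_of_isTubeBoundary (G := G) (Γ := ℤˣ) (V := Euc 3) (B := Euc 0)
    hf.isLocalDiffeomorph (ContinuousLinearEquiv.ofFinrankEq (by simp))
    TwoSphere.isTubeBoundary_inclusion TwoSphere.inclusion_smul
    (K := Metric.closedBall 0 1 ×ˢ {0}) ((isCompact_closedBall _ _).prod isCompact_singleton)
    (fun v hv => mem_closedBall_zero_iff.1 hv.1)
    (fun v hv => ⟨1, by
      rw [one_smul]
      exact ⟨mem_closedBall_zero_iff.2 hv, Subsingleton.elim _ _⟩⟩)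
    (fun q => by
      obtain ⟨a, ha⟩ := hf.surjective (p q)
      obtain ⟨F, hF⟩ := hf.exists_bundleLift hp ha.symm
      exact ⟨F, a, hF⟩)
    (fun F a b hab => by rw [TwoSphere.inclusion_injective hab]) F₀
  exact ⟨isUnionOfSpheres_of_representatives hp hf hfree hR hR',
    ⟨_, _, _, _, _, hH, isUnionOfBalls_of_representatives hfree hR hR' H⟩⟩

end ProjectivePlane

end

theorem mainTheorem7 {G : Type v} [Group G] [Finite G]
    {Q : Type u} [TopologicalSpace Q] [ChartedSpace (Euc 2) Q] [IsManifold (𝓡 2) ∞ Q]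
    [T2Space Q] [CompactSpace Q] [MulAction G Q]
    {M : Type w} [TopologicalSpace M] [ChartedSpace (Euc 2) M] [IsManifold (𝓡 2) ∞ M]
    [T2Space M] [CompactSpace M]
    (p : Q → M) (hp : IsPrincipalBundle G p) :
    (IsTorus M → IsExtendable G Q) ∧
    (IsKleinBottle M → IsExtendable G Q) ∧
    (∀ (f : TwoSphere → M) (x : G), IsProjectivePlane f → HasMonodromy p (middleCircle f) x →
      x ^ 2 = 1 → x ≠ 1 →
        IsExtendable G Q ∧
        IsUnionOfSpheres (Nat.card G / 2) Q ∧
        IsExtendableToBalls (Nat.card G / 2) G Q) := by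
  refine ⟨?_, ?_, ?_⟩
  · rintro ⟨f, hf⟩
    -- The sign `ε` is `1` for the torus and `-1` for the Klein bottle.
    refine isExtendable_of_flat hp 1 (f := f) ?_
    simpa using hf
  · rintro ⟨f, hf⟩
    refine isExtendable_of_flat hp (-1) (f := f) ?_
    have h : ∀ m : ℤ, ((((-1) ^ m : ℤˣ) : ℤ) : ℝ) = (-1) ^ m := fun m => by
      rcases Int.even_or_odd m with hm | hm
      · simp [hm.neg_one_zpow]
      · simp [hm.neg_one_zpow]
    simpa only [h] using hf
  · intro f x hf hx hx2 hx1
    obtain ⟨h1, h2⟩ := isExtendableToBalls_of_isProjectivePlane hp hf hx hx2 hx1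
    refine ⟨?_, h1, h2⟩
    obtain ⟨W, t, c, m, i, h3, -⟩ := h2
    exact ⟨W, t, c, m, i, h3⟩
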